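/- Let $-\infty\le a<b\le\infty$, let $J\in\mathbb C^{n\times n}$ be constant, invertible and skew-Hermitian, and let $q,w$ be $n\times n$ matrices of distributions of order $0$ on $(a,b)$ (distributional derivatives of functions of locally bounded variation, equivalently local complex measures), with $q$ Hermitian and $w$ non-negative. A function $u$ of locally bounded variation is called balanced if $u=(u^-+u^+)/2$, where $u^\pm$ are its right- and left-hand limits. Let $\mathcal L^2(w)$ be the space of ($\mathbb C^n$-valued, measurable) functions $f$ with $\int f^*wf<\infty$, and let $L^2(w)$ be its quotient by the functions with $\int f^*wf=0$; $[f]$ denotes the class of $f$. Let $T_{\max}$ be the maximal relation $$T_{\max}=\{([u],[f])\in L^2(w)\times L^2(w): u \text{ balanced, of locally bounded variation on }(a,b),\ Ju'+qu=wf\},$$ and let the minimal relation $T_{\min}$ consist of the pairs $([u],[f])$ in $T_{\max}$ that have representatives $(u,f)$ as above for which, in addition, $\operatorname{supp}u$ is compact in $(a,b)$. For $\lambda\in\mathbb C$ put $D_\lambda=\{([u],\lambda[u])\in T_{\max}\}$; the numbers $n_\pm=\dim D_{\pm i}$ are called the deficiency indices of $T_{\min}$. The endpoint $a$ (respectively $b$)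 is called regular if, for some $c\in(a,b)$, the left-continuous antiderivatives of $q$ and $w$ are of bounded variation on $(a,c)$ (respectively on $(c,b)$). If both endpoints $a$ and $b$ are regular, then $n_+=n_-$. (No unique continuation property for the equation is assumed.) -/

import Mathlib

set_option linter.unusedSectionVars false

namespace BVSystem

open MeasureTheory Set Topology Filter
open scoped ComplexOrder Matrix

section Measures

variable {α : Type} [LinearOrder α] [DenselyOrdered α] [NoMinOrder α] [NoMaxOrder α]
  [TopologicalSpace α] [OrderTopology α] [SecondCountableTopology α] [CompactIccSpace α]
  [MeasurableSpace α] [BorelSpace α]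

theorem leftLim_rightLim_of_leftCont {m : α → ℝ} (hm : Monotone m)
    (hc : ∀ x, ContinuousWithinAt m (Iio x) x) (x : α) :
    Function.leftLim (Function.rightLim m) x = m x := by
  have h : Tendsto m (𝓝[<] x) (𝓝 (Function.leftLim m x)) := hm.tendsto_leftLim x
  exact (_root_.leftLim_rightLim h).trans (leftLim_eq_of_tendsto (hc x))

theorem stieltjes_Ico {m : α → ℝ} (hm : Monotone m)
    (hc : ∀ x, ContinuousWithinAt m (Iio x) x) (c d : α) :
    hm.stieltjesFunction.measure (Ico c d) = ENNReal.ofReal (m d - m c) := by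
  rw [StieltjesFunction.measure_Ico]
  have := leftLim_rightLim_of_leftCont hm hc
  change ENNReal.ofReal (Function.leftLim (Function.rightLim m) d -
    Function.leftLim (Function.rightLim m) c) = _
  rw [this, this]

theorem exists_density_real {m : α → ℝ} (hm : Monotone m)
    (hc : ∀ x, ContinuousWithinAt m (Iio x) x) {G : α → ℝ}
    (hG : ∀ x, ContinuousWithinAt G (Iio x) x)
    (hGm : ∀ c d, c ≤ d → |G d - G c| ≤ m d - m c) :
    ∃ g : α → ℝ, Measurable g ∧ ∀ c d, c ≤ d →
      IntegrableOn g (Ico c d) hm.stieltjesFunction.measure ∧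
      ∫ x in Ico c d, g x ∂hm.stieltjesFunction.measure = G d - G c := by
  have h1 : Monotone (m + G) := fun c d h => by
    have := (abs_le.1 (hGm c d h)).1; simp; linarith
  have h2 : Monotone (m - G) := fun c d h => by
    have := (abs_le.1 (hGm c d h)).2; simp; linarith
  have hc1 : ∀ x, ContinuousWithinAt (m + G) (Iio x) x := fun x => (hc x).add (hG x)
  have hc2 : ∀ x, ContinuousWithinAt (m - G) (Iio x) x := fun x => (hc x).sub (hG x)
  set μ := hm.stieltjesFunction.measure with hμ
  set ν := h1.stieltjesFunction.measure with hν
  have hsum : ν + h2.stieltjesFunction.measure = (2 : ENNReal) • μ := by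
    refine Measure.ext_of_Ico' _ _ (fun c d h => ?_) (fun c d h => ?_)
    · simp [hν, stieltjes_Ico h1 hc1, stieltjes_Ico h2 hc2]
    · simp only [hν, hμ, Measure.add_apply, Measure.smul_apply, stieltjes_Ico h1 hc1,
        stieltjes_Ico h2 hc2, stieltjes_Ico hm hc]
      rw [← ENNReal.ofReal_add (sub_nonneg.2 (h1 h.le)) (sub_nonneg.2 (h2 h.le)), smul_eq_mul,
        show (2 : ENNReal) = ENNReal.ofReal 2 by simp, ← ENNReal.ofReal_mul (by norm_num)]
      congr 1; simp; ring
  have hac : ν ≪ μ := by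
    intro s hs
    have : (ν + h2.stieltjesFunction.measure) s = 0 := by rw [hsum]; simp [hs]
    simp at this; exact this.1
  refine ⟨fun x => (ν.rnDeriv μ x).toReal - 1,
    (Measure.measurable_rnDeriv _ _).ennreal_toReal.sub_const _, fun c d h => ?_⟩
  have hfin : μ (Ico c d) ≠ ⊤ := by simp [hμ, stieltjes_Ico hm hc]
  have i1 : IntegrableOn (fun x => (ν.rnDeriv μ x).toReal) (Ico c d) μ := by
    apply integrable_toReal_of_lintegral_ne_top (Measure.measurable_rnDeriv _ _).aemeasurable
    apply ne_top_of_le_ne_top _ (Measure.setLIntegral_rnDeriv_le _)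
    simp [hν, stieltjes_Ico h1 hc1]
  have i2 : IntegrableOn (fun _ => (1 : ℝ)) (Ico c d) μ := by
    simp [integrableOn_const_iff, hfin.lt_top]
  refine ⟨i1.sub i2, ?_⟩
  rw [integral_sub i1 i2, Measure.setIntegral_toReal_rnDeriv hac]
  simp only [integral_const, measureReal_def, hν, hμ, stieltjes_Ico h1 hc1, stieltjes_Ico hm hc,
    Measure.restrict_apply MeasurableSet.univ, univ_inter, smul_eq_mul, mul_one]
  rw [ENNReal.toReal_ofReal (sub_nonneg.2 (h1 h)), ENNReal.toReal_ofReal (sub_nonneg.2 (hm h))]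
  simp only [Pi.add_apply]; ring

theorem exists_density_complex {m : α → ℝ} (hm : Monotone m)
    (hc : ∀ x, ContinuousWithinAt m (Iio x) x) {G : α → ℂ}
    (hG : ∀ x, ContinuousWithinAt G (Iio x) x)
    (hGm : ∀ c d, c ≤ d → ‖G d - G c‖ ≤ m d - m c) :
    ∃ g : α → ℂ, Measurable g ∧ ∀ c d, c ≤ d →
      IntegrableOn g (Ico c d) hm.stieltjesFunction.measure ∧
      ∫ x in Ico c d, g x ∂hm.stieltjesFunction.measure = G d - G c := by
  obtain ⟨g1, m1, h1⟩ := exists_density_real hm hc (G := fun x => (G x).re)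
    (fun x => Complex.continuous_re.continuousAt.comp_continuousWithinAt (hG x))
    (fun c d h => (Complex.abs_re_le_norm (G d - G c)).trans (hGm c d h))
  obtain ⟨g2, m2, h2⟩ := exists_density_real hm hc (G := fun x => (G x).im)
    (fun x => Complex.continuous_im.continuousAt.comp_continuousWithinAt (hG x))
    (fun c d h => (Complex.abs_im_le_norm (G d - G c)).trans (hGm c d h))
  refine ⟨fun x => g1 x + g2 x * Complex.I, by fun_prop, fun c d h => ?_⟩
  have i1 := (h1 c d h).1.ofReal (𝕜 := ℂ)
  have i2 := ((h2 c d h).1.ofReal (𝕜 := ℂ)).mul_const Complex.I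
  refine ⟨i1.add i2, ?_⟩
  refine (integral_add i1 i2).trans ?_
  rw [integral_mul_const]
  have e1 := integral_ofReal (𝕜 := ℂ) (f := g1) (μ := hm.stieltjesFunction.measure.restrict (Ico c d))
  have e2 := integral_ofReal (𝕜 := ℂ) (f := g2) (μ := hm.stieltjesFunction.measure.restrict (Ico c d))
  rw [(h1 c d h).2] at e1
  rw [(h2 c d h).2] at e2
  erw [e1, e2]
  apply Complex.ext <;> simp

theorem ae_nonneg_of_Ico {μ : Measure α} {g : α → ℝ} (hg : Measurable g) {F : α → ℝ}
    (hF : Monotone F) (hc : ∀ x, ContinuousWithinAt F (Iio x) x)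
    (hi : ∀ c d, c ≤ d → IntegrableOn g (Ico c d) μ ∧ ∫ x in Ico c d, g x ∂μ = F d - F c) :
    ∀ᵐ x ∂μ, 0 ≤ g x := by
  set P := μ.withDensity fun x => ENNReal.ofReal (g x) with hP
  set N := μ.withDensity fun x => ENNReal.ofReal (-g x) with hN
  have hfin : ∀ c d, c ≤ d → P (Ico c d) ≠ ⊤ ∧ N (Ico c d) ≠ ⊤ := by
    intro c d h
    have hi' := (hi c d h).1
    rw [hP, hN, withDensity_apply _ measurableSet_Ico, withDensity_apply _ measurableSet_Ico]
    exact ⟨hi'.lintegral_lt_top.ne, hi'.neg.lintegral_lt_top.ne⟩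
  have hPN : P = N + hF.stieltjesFunction.measure := by
    refine Measure.ext_of_Ico' _ _ (fun c d h => (hfin c d h.le).1) (fun c d h => ?_)
    have h2 := (hi c d h.le).2
    rw [integral_eq_lintegral_pos_part_sub_lintegral_neg_part (hi c d h.le).1] at h2
    have e1 := hfin c d h.le
    rw [Measure.add_apply, stieltjes_Ico hF hc, ← h2]
    rw [hP, hN, withDensity_apply _ measurableSet_Ico, withDensity_apply _ measurableSet_Ico] at *
    have h3 : 0 ≤ F d - F c := sub_nonneg.2 (hF h.le)
    rw [← h2] at h3
    rw [← ENNReal.toReal_eq_toReal_iff' e1.1 (by simp [e1.2]),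
      ENNReal.toReal_add e1.2 ENNReal.ofReal_ne_top, ENNReal.toReal_ofReal h3]
    ring
  have hle : N {x | g x < 0} = 0 := by
    have hms : MeasurableSet {x | g x < 0} := measurableSet_lt hg measurable_const
    have h1 : P {x | g x < 0} = 0 := by
      rw [hP, withDensity_apply _ hms, setLIntegral_eq_zero_iff hms hg.ennreal_ofReal]
      exact Eventually.of_forall fun x hx => ENNReal.ofReal_of_nonpos (le_of_lt hx)
    rw [hPN, Measure.add_apply] at h1
    simp only [add_eq_zero] at h1
    exact h1.1
  have hms : MeasurableSet {x | g x < 0} := measurableSet_lt hg measurable_const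
  rw [hN, withDensity_apply _ hms, setLIntegral_eq_zero_iff hms
    (show Measurable fun x => ENNReal.ofReal (-g x) from hg.neg.ennreal_ofReal)] at hle
  filter_upwards [hle] with x hx
  by_contra hlt
  have := hx (not_le.1 hlt)
  simp at this
  exact hlt this

end Measures

/-- An `n × n` matrix of distributions of order `0` on an open interval `α`: the distributional
derivative `dM` of a matrix function `M` of locally bounded variation. It is recorded through its
left-continuous antiderivative `M`, which is unique up to an additive constant; as a (local) matrix
measure it satisfies `dM [c, d) = M d - M c`. -/
structure MatrixDistribution (α : Type) [LinearOrder α] [TopologicalSpace α] (n : ℕ) where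
  antideriv : α → Matrix (Fin n) (Fin n) ℂ
  leftCont : ∀ x, ContinuousWithinAt antideriv (Iio x) x
  locBV : ∀ i j, LocallyBoundedVariationOn (fun x => antideriv x i j) univ

namespace MatrixDistribution

variable {α : Type} [LinearOrder α] [DenselyOrdered α] [NoMinOrder α] [NoMaxOrder α]
  [TopologicalSpace α] [OrderTopology α] [SecondCountableTopology α] [CompactIccSpace α]
  [MeasurableSpace α] [BorelSpace α] {n : ℕ}

/-- Sum of the total variation functions of the entries of `M`, normalised at a base point that
does not depend on `x`. -/
noncomputable def variationFun (M : MatrixDistribution α n) (x : α) : ℝ :=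
  ∑ i, ∑ j, variationOnFromTo (fun y => M.antideriv y i j) univ (Classical.choice ⟨x⟩) x

theorem variationFun_mono (M : MatrixDistribution α n) : Monotone M.variationFun := by
  intro x y h
  exact Finset.sum_le_sum fun i _ => Finset.sum_le_sum fun j _ =>
    variationOnFromTo.monotoneOn (M.locBV i j) (mem_univ _) (mem_univ x) (mem_univ y) h

theorem entry_leftCont (M : MatrixDistribution α n) (i j : Fin n) (x : α) :
    ContinuousWithinAt (fun y => M.antideriv y i j) (Iio x) x :=
  tendsto_pi_nhds.1 (tendsto_pi_nhds.1 (M.leftCont x) i) j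

theorem variationFun_leftCont (M : MatrixDistribution α n) (x : α) :
    ContinuousWithinAt M.variationFun (Iio x) x := by
  apply tendsto_finsetSum
  intro i _
  apply tendsto_finsetSum
  intro j _
  have := variationOnFromTo.tendsto_left (a := Classical.choice ⟨x⟩) (b := x) (s := univ)
    (mem_univ _) (mem_univ _) (M.locBV i j) (by rw [univ_inter]; exact M.entry_leftCont i j x)
  simpa using this

theorem norm_entry_sub_le (M : MatrixDistribution α n) (i j : Fin n) {c d : α} (h : c ≤ d) :
    ‖M.antideriv d i j - M.antideriv c i j‖ ≤ M.variationFun d - M.variationFun c := by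
  have key : ∀ i j, 0 ≤ variationOnFromTo (fun y => M.antideriv y i j) univ c d := fun i j =>
    variationOnFromTo.nonneg_of_le _ _ h
  have e : M.variationFun d - M.variationFun c =
      ∑ i, ∑ j, variationOnFromTo (fun y => M.antideriv y i j) univ c d := by
    unfold variationFun
    simp only [← Finset.sum_sub_distrib]
    refine Finset.sum_congr rfl fun i _ => Finset.sum_congr rfl fun j _ => ?_
    rw [variationOnFromTo.sub_right (M.locBV i j) (mem_univ _) (mem_univ _) (mem_univ _)]
  rw [e]
  calc _ ≤ variationOnFromTo (fun y => M.antideriv y i j) univ c d := by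
        rw [variationOnFromTo.eq_of_le _ _ h, ← dist_eq_norm, dist_edist]
        refine ENNReal.toReal_mono (M.locBV i j c d (mem_univ _) (mem_univ _)) ?_
        exact eVariationOn.edist_le (fun y => M.antideriv y i j)
          ⟨mem_univ _, h, le_rfl⟩ ⟨mem_univ _, le_rfl, h⟩
    _ ≤ ∑ j, variationOnFromTo (fun y => M.antideriv y i j) univ c d :=
        Finset.single_le_sum (fun j _ => key i j) (Finset.mem_univ j)
    _ ≤ _ := Finset.single_le_sum
        (f := fun i => ∑ j, variationOnFromTo (fun y => M.antideriv y i j) univ c d)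
        (fun i _ => Finset.sum_nonneg fun j _ => key i j) (Finset.mem_univ i)

/-- The positive locally finite measure `|dM| = ∑ i j, |dM i j|`. -/
noncomputable def variation (M : MatrixDistribution α n) : Measure α :=
  M.variationFun_mono.stieltjesFunction.measure

/-- `dM` is non-negative: it takes positive semidefinite values (on half-open intervals, hence on
all relatively compact Borel sets). -/
def IsNonneg (M : MatrixDistribution α n) : Prop :=
  ∀ c d, c ≤ d → (M.antideriv d - M.antideriv c).PosSemidef

/-- `dM` is Hermitian. -/
def IsHermitian (M : MatrixDistribution α n) : Prop :=
  ∀ c d, c ≤ d → (M.antideriv d - M.antideriv c).IsHermitian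

theorem integral_form (M : MatrixDistribution α n) {A : α → Matrix (Fin n) (Fin n) ℂ}
    {c d : α} (hA : ∀ i j, IntegrableOn (fun x => A x i j) (Ico c d) M.variation ∧
      ∫ x in Ico c d, A x i j ∂M.variation = M.antideriv d i j - M.antideriv c i j)
    (v : Fin n → ℂ) :
    IntegrableOn (fun x => star v ⬝ᵥ (A x *ᵥ v)) (Ico c d) M.variation ∧
      ∫ x in Ico c d, star v ⬝ᵥ (A x *ᵥ v) ∂M.variation =
        star v ⬝ᵥ ((M.antideriv d - M.antideriv c) *ᵥ v) := by
  simp only [dotProduct, Matrix.mulVec, Finset.mul_sum, Matrix.sub_apply]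
  have h : ∀ i j, IntegrableOn (fun x => star v i * (A x i j * v j)) (Ico c d) M.variation :=
    fun i j => ((hA i j).1.mul_const _).const_mul _
  refine ⟨integrable_finsetSum _ fun i _ => integrable_finsetSum _ fun j _ => h i j, ?_⟩
  rw [integral_finsetSum _ fun i _ => integrable_finsetSum _ fun j _ => h i j]
  refine Finset.sum_congr rfl fun i _ => ?_
  rw [integral_finsetSum _ fun j _ => h i j]
  refine Finset.sum_congr rfl fun j _ => ?_
  rw [integral_const_mul, integral_mul_const, (hA i j).2]

theorem exists_density (M : MatrixDistribution α n) :
    ∃ A : α → Matrix (Fin n) (Fin n) ℂ, (∀ i j, Measurable fun x => A x i j) ∧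
      (∀ c d, c ≤ d → ∀ i j, IntegrableOn (fun x => A x i j) (Ico c d) M.variation ∧
        ∫ x in Ico c d, A x i j ∂M.variation = M.antideriv d i j - M.antideriv c i j) ∧
      (M.IsNonneg → ∀ x, (A x).PosSemidef) := by
  have h0 := fun i j => exists_density_complex M.variationFun_mono M.variationFun_leftCont
    (M.entry_leftCont i j) (fun c d h => M.norm_entry_sub_le i j h)
  choose A hAm hA using h0
  by_cases hM : M.IsNonneg
  swap
  · exact ⟨fun x => Matrix.of fun i j => A i j x, hAm, fun c d h i j => hA i j c d h,
      fun h => absurd h hM⟩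
  let B : α → Matrix (Fin n) (Fin n) ℂ := fun x => Matrix.of fun i j => A i j x
  have hB : ∀ c d, c ≤ d → ∀ i j, IntegrableOn (fun x => B x i j) (Ico c d) M.variation ∧
      ∫ x in Ico c d, B x i j ∂M.variation = M.antideriv d i j - M.antideriv c i j :=
    fun c d h i j => hA i j c d h
  have hBm : ∀ v : Fin n → ℂ, Measurable fun x => star v ⬝ᵥ (B x *ᵥ v) := by
    intro v
    simp only [dotProduct, Matrix.mulVec]
    have : ∀ i j, Measurable fun x => B x i j := hAm
    fun_prop
  have hv : ∀ v : Fin n → ℂ, ∀ᵐ x ∂M.variation, 0 ≤ star v ⬝ᵥ (B x *ᵥ v) := by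
    intro v
    have hre : ∀ᵐ x ∂M.variation, 0 ≤ (star v ⬝ᵥ (B x *ᵥ v)).re := by
      refine ae_nonneg_of_Ico (Complex.measurable_re.comp (hBm v))
        (F := fun x => (star v ⬝ᵥ (M.antideriv x *ᵥ v)).re) ?_ ?_ ?_
      · intro c d h
        have := (Complex.le_def.1 ((hM c d h).dotProduct_mulVec_nonneg v)).1
        simp only [Matrix.sub_mulVec, dotProduct_sub, Complex.sub_re, Complex.zero_re] at this
        linarith
      · intro x
        have hcont : Continuous fun B : Matrix (Fin n) (Fin n) ℂ => (star v ⬝ᵥ (B *ᵥ v)).re := by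
          fun_prop
        exact hcont.continuousAt.comp_continuousWithinAt (M.leftCont x)
      · intro c d h
        have := M.integral_form (hB c d h) v
        refine ⟨this.1.re, ?_⟩
        have e := Complex.reCLM.integral_comp_comm this.1
        simp only [Complex.reCLM_apply] at e
        rw [e, this.2]
        simp [Matrix.sub_mulVec, dotProduct_sub]
    have him : ∀ s : ℝ, ∀ᵐ x ∂M.variation, 0 ≤ s * (star v ⬝ᵥ (B x *ᵥ v)).im := by
      intro s
      refine ae_nonneg_of_Ico ((Complex.measurable_im.comp (hBm v)).const_mul s)
        (F := fun x => 0) monotone_const (fun x => continuousWithinAt_const) ?_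
      intro c d h
      have := M.integral_form (hB c d h) v
      refine ⟨this.1.im.const_mul s, ?_⟩
      have e := Complex.imCLM.integral_comp_comm this.1
      simp only [Complex.imCLM_apply] at e
      rw [integral_const_mul, e, this.2,
        ← (Complex.le_def.1 ((hM c d h).dotProduct_mulVec_nonneg v)).2]
      simp
    filter_upwards [hre, him 1, him (-1)] with x h1 h2 h3
    exact Complex.le_def.2 ⟨h1, by simp at h2 h3 ⊢; linarith⟩
  obtain ⟨D, hDc, hDd⟩ := TopologicalSpace.exists_countable_dense (Fin n → ℂ)
  let S : Set α := {x | ∀ v ∈ D, 0 ≤ star v ⬝ᵥ (B x *ᵥ v)}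
  have hS : MeasurableSet S := by
    have : S = ⋂ v ∈ D, {x | 0 ≤ star v ⬝ᵥ (B x *ᵥ v)} := by ext x; simp [S]
    rw [this]
    exact MeasurableSet.biInter hDc fun v _ => hBm v isClosed_Ici.measurableSet
  have hSae : ∀ᵐ x ∂M.variation, x ∈ S := (ae_ball_iff hDc).2 fun v _ => hv v
  have hpsd : ∀ x ∈ S, (B x).PosSemidef := by
    intro x hx
    have hx' : ∀ v, 0 ≤ star v ⬝ᵥ (B x *ᵥ v) := by
      have hcl : IsClosed {v : Fin n → ℂ | 0 ≤ star v ⬝ᵥ (B x *ᵥ v)} :=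
        isClosed_le continuous_const (by fun_prop)
      intro v
      exact hcl.closure_subset_iff.2 hx (hDd v)
    rw [← Matrix.isPositive_toEuclideanLin_iff, LinearMap.isPositive_iff_complex]
    intro v
    have h := Complex.nonneg_iff.1 (hx' v.ofLp)
    have e : inner ℂ ((B x).toEuclideanLin v) v = star (star v.ofLp ⬝ᵥ (B x *ᵥ v.ofLp)) := by
      rw [EuclideanSpace.inner_eq_star_dotProduct]
      simp only [Matrix.ofLp_toLpLin, Matrix.toLin'_apply]
      rw [Matrix.star_dotProduct, star_star, dotProduct_comm]
    rw [e]
    refine ⟨?_, by simpa using h.1⟩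
    apply Complex.ext
    · simp
    · simpa using h.2.symm
  classical
  refine ⟨S.piecewise B 0, fun i j => ?_, fun c d h i j => ?_, fun _ x => ?_⟩
  · have : (fun x => S.piecewise B 0 x i j) = S.piecewise (fun x => B x i j) 0 := by
      ext x; by_cases hx : x ∈ S <;> simp [hx]
    rw [this]
    exact (hAm i j).piecewise hS measurable_const
  · have : (fun x => B x i j) =ᵐ[M.variation.restrict (Ico c d)]
        fun x => S.piecewise B 0 x i j := by
      filter_upwards [ae_restrict_of_ae hSae] with x hx
      simp [hx]
    exact ⟨(hB c d h i j).1.congr this, (integral_congr_ae this).symm.trans (hB c d h i j).2⟩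
  · by_cases hx : x ∈ S
    · simpa [hx] using hpsd x hx
    · simpa [hx] using Matrix.PosSemidef.zero

/-- The Radon-Nikodym density of the matrix measure `dM` with respect to `|dM|`, with pointwise
positive semidefinite values when `dM` is non-negative. -/
noncomputable def density (M : MatrixDistribution α n) : α → Matrix (Fin n) (Fin n) ℂ :=
  M.exists_density.choose

theorem measurable_density (M : MatrixDistribution α n) (i j : Fin n) :
    Measurable fun x => M.density x i j :=
  M.exists_density.choose_spec.1 i j

theorem integrableOn_density (M : MatrixDistribution α n) {c d : α} (h : c ≤ d) (i j : Fin n) :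
    IntegrableOn (fun x => M.density x i j) (Ico c d) M.variation :=
  (M.exists_density.choose_spec.2.1 c d h i j).1

theorem integral_density (M : MatrixDistribution α n) {c d : α} (h : c ≤ d) (i j : Fin n) :
    ∫ x in Ico c d, M.density x i j ∂M.variation = M.antideriv d i j - M.antideriv c i j :=
  (M.exists_density.choose_spec.2.1 c d h i j).2

theorem posSemidef_density (M : MatrixDistribution α n) (hM : M.IsNonneg) (x : α) :
    (M.density x).PosSemidef :=
  M.exists_density.choose_spec.2.2 hM x

/-- The vector `∫_s dM g`. -/
noncomputable def integralOn (M : MatrixDistribution α n) (g : α → Fin n → ℂ) (s : Set α) :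
    Fin n → ℂ :=
  ∫ x in s, M.density x *ᵥ g x ∂M.variation

end MatrixDistribution

section BV

variable {α : Type} [LinearOrder α] [DenselyOrdered α] [NoMinOrder α] [NoMaxOrder α]
  [TopologicalSpace α] [OrderTopology α] [SecondCountableTopology α] [CompactIccSpace α]
  [MeasurableSpace α] [BorelSpace α] {n : ℕ}

/-- `u` is a balanced function of locally bounded variation: `u = (u⁻ + u⁺) / 2`. -/
def IsBalancedBV (u : α → Fin n → ℂ) : Prop :=
  LocallyBoundedVariationOn u univ ∧
    ∀ x, u x = (2⁻¹ : ℂ) • (Function.leftLim u x + Function.rightLim u x)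

theorem locBV_tendsto {u : α → Fin n → ℂ} (hu : LocallyBoundedVariationOn u univ) (x : α) :
    Tendsto u (𝓝[<] x) (𝓝 (Function.leftLim u x)) ∧
      Tendsto u (𝓝[>] x) (𝓝 (Function.rightLim u x)) := by
  obtain ⟨c, hc⟩ := exists_lt x
  obtain ⟨d, hd⟩ := exists_gt x
  have h := hu c d (mem_univ _) (mem_univ _)
  obtain ⟨l, hl⟩ := h.exists_tendsto_left x
  obtain ⟨r, hr⟩ := h.exists_tendsto_right x
  rw [univ_inter] at hl hr
  constructor
  · refine tendsto_leftLim_of_tendsto ⟨l, hl.mono_left ?_⟩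
    exact nhdsWithin_inter_of_mem (mem_nhdsWithin_of_mem_nhds (Icc_mem_nhds hc hd)) |>.ge
  · refine tendsto_rightLim_of_tendsto ⟨r, hr.mono_left ?_⟩
    exact nhdsWithin_inter_of_mem (mem_nhdsWithin_of_mem_nhds (Icc_mem_nhds hc hd)) |>.ge

theorem locBV_add {u v : α → Fin n → ℂ} (hu : LocallyBoundedVariationOn u univ)
    (hv : LocallyBoundedVariationOn v univ) : LocallyBoundedVariationOn (u + v) univ := by
  intro c d hc hd
  have h1 := hu c d hc hd
  have h2 := hv c d hc hd
  refine ne_top_of_le_ne_top (ENNReal.add_ne_top.2 ⟨h1, h2⟩) (iSup_le fun p => ?_)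
  calc _ ≤ ∑ i ∈ Finset.range p.1, (edist (u (p.2.1 (i + 1))) (u (p.2.1 i)) +
          edist (v (p.2.1 (i + 1))) (v (p.2.1 i))) :=
        Finset.sum_le_sum fun i _ => edist_add_add_le _ _ _ _
    _ = _ := Finset.sum_add_distrib
    _ ≤ _ := add_le_add (eVariationOn.sum_le p.2.2.1 p.2.2.2) (eVariationOn.sum_le p.2.2.1 p.2.2.2)

theorem locBV_smul (k : ℂ) {u : α → Fin n → ℂ} (hu : LocallyBoundedVariationOn u univ) :
    LocallyBoundedVariationOn (k • u) univ :=
  (lipschitzWith_smul k).comp_locallyBoundedVariationOn hu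

theorem leftLim_add' {u v : α → Fin n → ℂ} (hu : LocallyBoundedVariationOn u univ)
    (hv : LocallyBoundedVariationOn v univ) (x : α) :
    Function.leftLim (u + v) x = Function.leftLim u x + Function.leftLim v x :=
  leftLim_eq_of_tendsto ((locBV_tendsto hu x).1.add (locBV_tendsto hv x).1)

theorem rightLim_add' {u v : α → Fin n → ℂ} (hu : LocallyBoundedVariationOn u univ)
    (hv : LocallyBoundedVariationOn v univ) (x : α) :
    Function.rightLim (u + v) x = Function.rightLim u x + Function.rightLim v x :=
  rightLim_eq_of_tendsto ((locBV_tendsto hu x).2.add (locBV_tendsto hv x).2)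

theorem leftLim_smul' (k : ℂ) {u : α → Fin n → ℂ} (hu : LocallyBoundedVariationOn u univ)
    (x : α) : Function.leftLim (k • u) x = k • Function.leftLim u x :=
  leftLim_eq_of_tendsto ((locBV_tendsto hu x).1.const_smul k)

theorem rightLim_smul' (k : ℂ) {u : α → Fin n → ℂ} (hu : LocallyBoundedVariationOn u univ)
    (x : α) : Function.rightLim (k • u) x = k • Function.rightLim u x :=
  rightLim_eq_of_tendsto ((locBV_tendsto hu x).2.const_smul k)

theorem IsBalancedBV.add {u v : α → Fin n → ℂ} (hu : IsBalancedBV u) (hv : IsBalancedBV v) :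
    IsBalancedBV (u + v) := by
  refine ⟨locBV_add hu.1 hv.1, fun x => ?_⟩
  rw [leftLim_add' hu.1 hv.1, rightLim_add' hu.1 hv.1, Pi.add_apply]
  conv_lhs => rw [hu.2 x, hv.2 x]
  module

theorem IsBalancedBV.smul (k : ℂ) {u : α → Fin n → ℂ} (hu : IsBalancedBV u) :
    IsBalancedBV (k • u) := by
  refine ⟨locBV_smul k hu.1, fun x => ?_⟩
  rw [leftLim_smul' k hu.1, rightLim_smul' k hu.1, Pi.smul_apply]
  conv_lhs => rw [hu.2 x]
  module

theorem IsBalancedBV.zero : IsBalancedBV (0 : α → Fin n → ℂ) := by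
  have h : LocallyBoundedVariationOn (0 : α → Fin n → ℂ) univ := fun c d _ _ => by
    rw [BoundedVariationOn, eVariationOn.constant_on]
    · exact ENNReal.zero_ne_top
    · rintro _ ⟨x, _, rfl⟩ _ ⟨y, _, rfl⟩; rfl
  refine ⟨h, fun x => ?_⟩
  have h1 : Function.leftLim (0 : α → Fin n → ℂ) x = 0 := leftLim_eq_of_tendsto tendsto_const_nhds
  have h2 : Function.rightLim (0 : α → Fin n → ℂ) x = 0 := rightLim_eq_of_tendsto tendsto_const_nhds
  simp [h1, h2]

theorem locBV_measurable {u : α → Fin n → ℂ} (hu : LocallyBoundedVariationOn u univ)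
    (i : Fin n) : Measurable fun x => u x i := by
  have key : ∀ L : (Fin n → ℂ) →L[ℝ] ℝ, Measurable fun x => L (u x) := by
    intro L
    obtain ⟨p, q, hp, hq, e⟩ := (L.lipschitz.comp_locallyBoundedVariationOn hu
      ).exists_monotoneOn_sub_monotoneOn
    have : (fun x => L (u x)) = p - q := e
    rw [this]
    exact (monotoneOn_univ.1 hp).measurable.sub (monotoneOn_univ.1 hq).measurable
  have h1 := key (Complex.reCLM ∘L ContinuousLinearMap.proj i)
  have h2 := key (Complex.imCLM ∘L ContinuousLinearMap.proj i)
  exact measurable_of_re_im (𝕜 := ℂ) h1 h2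

theorem locBV_bounded {u : α → Fin n → ℂ} (hu : LocallyBoundedVariationOn u univ) (c d : α) :
    ∃ K, ∀ x ∈ Icc c d, ‖u x‖ ≤ K := by
  refine ⟨‖u c‖ + (eVariationOn u (univ ∩ Icc c d)).toReal, fun x hx => ?_⟩
  have := (hu c d (mem_univ _) (mem_univ _)).dist_le (x := x) (y := c) ⟨mem_univ _, hx⟩
    ⟨mem_univ _, le_rfl, hx.1.trans hx.2⟩
  rw [dist_eq_norm] at this
  have h2 := norm_le_norm_add_norm_sub' (u x) (u c)
  linarith

end BV

/-- The coefficients of the equation `J u' + q u = w f`: a constant invertible skew-Hermitian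
matrix `J`, and matrices `q` (Hermitian) and `w` (non-negative) of distributions of order `0`. -/
structure System (α : Type) [LinearOrder α] [TopologicalSpace α] (n : ℕ) where
  J : Matrix (Fin n) (Fin n) ℂ
  q : MatrixDistribution α n
  w : MatrixDistribution α n
  isUnit_J : IsUnit J
  skew_J : Jᴴ = -J
  hermitian_q : q.IsHermitian
  nonneg_w : w.IsNonneg

namespace System

variable {α : Type} [LinearOrder α] [DenselyOrdered α] [NoMinOrder α] [NoMaxOrder α]
  [TopologicalSpace α] [OrderTopology α] [SecondCountableTopology α] [CompactIccSpace α]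
  [MeasurableSpace α] [BorelSpace α] {n : ℕ}

/-- The left endpoint is regular: the antiderivatives of `q` and `w` are of bounded variation
on `(a, c)` for some interior point `c`. -/
def RegularLeft (S : System α n) : Prop :=
  ∃ c : α, ∀ i j, BoundedVariationOn (fun x => S.q.antideriv x i j) (Iio c) ∧
    BoundedVariationOn (fun x => S.w.antideriv x i j) (Iio c)

/-- The right endpoint is regular: the antiderivatives of `q` and `w` are of bounded variation
on `(c, b)` for some interior point `c`. -/
def RegularRight (S : System α n) : Prop :=
  ∃ c : α, ∀ i j, BoundedVariationOn (fun x => S.q.antideriv x i j) (Ioi c) ∧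
    BoundedVariationOn (fun x => S.w.antideriv x i j) (Ioi c)

/-- The density of `f* w g` with respect to the positive measure `|w|`. -/
noncomputable def wForm (S : System α n) (f g : α → Fin n → ℂ) (x : α) : ℂ :=
  star (f x) ⬝ᵥ (S.w.density x *ᵥ g x)

/-- `f` belongs to `𝓛²(w)`, that is, `∫ f* w f < ∞`. -/
def MemL2 (S : System α n) (f : α → Fin n → ℂ) : Prop :=
  AEMeasurable f S.w.variation ∧ Integrable (S.wForm f f) S.w.variation

theorem wForm_nonneg (S : System α n) (f : α → Fin n → ℂ) (x : α) : 0 ≤ S.wForm f f x :=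
  (S.w.posSemidef_density S.nonneg_w x).dotProduct_mulVec_nonneg _

theorem aemeasurable_wForm (S : System α n) {f g : α → Fin n → ℂ}
    (hf : AEMeasurable f S.w.variation) (hg : AEMeasurable g S.w.variation) :
    AEMeasurable (S.wForm f g) S.w.variation := by
  have h1 : ∀ i, AEMeasurable (fun x => f x i) S.w.variation := fun i =>
    (measurable_pi_apply i).comp_aemeasurable hf
  have h2 : ∀ i, AEMeasurable (fun x => g x i) S.w.variation := fun i =>
    (measurable_pi_apply i).comp_aemeasurable hg
  have h3 : ∀ i j, AEMeasurable (fun x => S.w.density x i j) S.w.variation := fun i j =>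
    (S.w.measurable_density i j).aemeasurable
  unfold wForm
  simp only [dotProduct, Matrix.mulVec, Pi.star_apply, RCLike.star_def]
  have h4 : ∀ i, AEMeasurable (fun x => (starRingEnd ℂ) (f x i)) S.w.variation := fun i =>
    Complex.continuous_conj.measurable.comp_aemeasurable (h1 i)
  fun_prop

theorem wForm_add_le (S : System α n) (f g : α → Fin n → ℂ) (x : α) :
    ‖S.wForm (f + g) (f + g) x‖ ≤ 2 * (‖S.wForm f f x‖ + ‖S.wForm g g x‖) := by
  have e : S.wForm (f + g) (f + g) x + S.wForm (f - g) (f - g) x =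
      2 * (S.wForm f f x + S.wForm g g x) := by
    simp only [wForm, Pi.add_apply, Pi.sub_apply, star_add, star_sub, Matrix.mulVec_add,
      Matrix.mulVec_sub, add_dotProduct, sub_dotProduct, dotProduct_add, dotProduct_sub]
    ring
  have h1 := S.wForm_nonneg (f + g) x
  have h2 := S.wForm_nonneg (f - g) x
  have hn : ∀ z : ℂ, 0 ≤ z → ‖z‖ = z.re := fun z hz => by
    rw [← Complex.ofReal_re ‖z‖, Complex.norm_of_nonneg' hz]
  have h3 : ‖S.wForm (f + g) (f + g) x‖ ≤
      ‖S.wForm (f + g) (f + g) x + S.wForm (f - g) (f - g) x‖ := by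
    rw [hn _ h1, hn _ (add_nonneg h1 h2), Complex.add_re]
    have := (Complex.nonneg_iff.1 h2).1
    linarith
  refine h3.trans ?_
  rw [e, norm_mul]
  simpa using norm_add_le _ _

theorem wForm_smul (S : System α n) (k : ℂ) (f : α → Fin n → ℂ) (x : α) :
    S.wForm (k • f) (k • f) x = (star k * k) * S.wForm f f x := by
  simp [wForm, Matrix.mulVec_smul, mul_assoc]
  ring

theorem MemL2.add {S : System α n} {f g : α → Fin n → ℂ} (hf : S.MemL2 f) (hg : S.MemL2 g) :
    S.MemL2 (f + g) :=
  ⟨hf.1.add hg.1, ((hf.2.norm.add hg.2.norm).const_mul 2).mono'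
    (S.aemeasurable_wForm (hf.1.add hg.1) (hf.1.add hg.1)).aestronglyMeasurable
    (Eventually.of_forall fun x => S.wForm_add_le f g x)⟩

theorem MemL2.smul {S : System α n} (k : ℂ) {f : α → Fin n → ℂ} (hf : S.MemL2 f) :
    S.MemL2 (k • f) :=
  ⟨hf.1.const_smul k, (hf.2.const_mul (star k * k)).congr
    (Eventually.of_forall fun x => (S.wForm_smul k f x).symm)⟩

theorem MemL2.zero (S : System α n) : S.MemL2 0 := by
  refine ⟨aemeasurable_const, ?_⟩
  have : S.wForm 0 0 = fun _ => 0 := by ext x; simp [wForm]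
  rw [this]; exact integrable_zero _ _ _

/-- The space `𝓛²(w)` of functions. -/
def preL2 (S : System α n) : Submodule ℂ (α → Fin n → ℂ) where
  carrier := {f | S.MemL2 f}
  add_mem' := MemL2.add
  zero_mem' := MemL2.zero S
  smul_mem' k _ h := h.smul k

/-- The semi-inner product `⟨f, g⟩ = ∫ f* w g`. -/
noncomputable def inner (S : System α n) (f g : α → Fin n → ℂ) : ℂ :=
  ∫ x, S.wForm f g x ∂S.w.variation

theorem inner_self_eq_zero_iff (S : System α n) {f : α → Fin n → ℂ} (hf : S.MemL2 f) :
    S.inner f f = 0 ↔ S.wForm f f =ᵐ[S.w.variation] 0 := by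
  refine ⟨fun h => ?_, fun h => by rw [inner, integral_congr_ae h]; simp⟩
  have e := Complex.reCLM.integral_comp_comm hf.2
  simp only [Complex.reCLM_apply] at e
  rw [show ∫ x, S.wForm f f x ∂S.w.variation = 0 from h, Complex.zero_re,
    integral_eq_zero_iff_of_nonneg (fun x => (Complex.nonneg_iff.1 (S.wForm_nonneg f x)).1)
      hf.2.re] at e
  filter_upwards [e] with x hx
  exact Complex.ext hx (Complex.nonneg_iff.1 (S.wForm_nonneg f x)).2.symm

/-- The elements of `𝓛²(w)` of norm zero. -/
def nullL2 (S : System α n) : Submodule ℂ S.preL2 where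
  carrier := {f | S.inner f f = 0}
  add_mem' := by
    intro f g hf hg
    have hf' := (S.inner_self_eq_zero_iff f.2).1 hf
    have hg' := (S.inner_self_eq_zero_iff g.2).1 hg
    refine (S.inner_self_eq_zero_iff (f + g).2).2 ?_
    filter_upwards [hf', hg'] with x h1 h2
    have := S.wForm_add_le f g x
    rw [h1, h2] at this
    simpa using this
  zero_mem' := by
    refine (S.inner_self_eq_zero_iff (0 : S.preL2).2).2 (Eventually.of_forall fun x => ?_)
    simp [wForm]
  smul_mem' := by
    intro k f hf
    have hf' := (S.inner_self_eq_zero_iff f.2).1 hf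
    refine (S.inner_self_eq_zero_iff (k • f).2).2 ?_
    filter_upwards [hf'] with x h1
    have := S.wForm_smul k f x
    rw [h1] at this
    simpa using this

/-- The Hilbert space `L²(w)` of classes of functions. -/
abbrev L2 (S : System α n) : Type := S.preL2 ⧸ S.nullL2

/-- `J u' + q u = w f`, for `u` of locally bounded variation, as an identity between distributions
of order `0`, i.e. between (local) measures; these are compared on the half-open intervals `[c, d)`,
where the measure `u'` has the value `u⁻(d) - u⁻(c)`. -/
def Solves (S : System α n) (u f : α → Fin n → ℂ) : Prop :=
  ∀ c d, c ≤ d → S.J *ᵥ (Function.leftLim u d - Function.leftLim u c) +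
    S.q.integralOn u (Ico c d) = S.w.integralOn f (Ico c d)

theorem integrable_q (S : System α n) {u : α → Fin n → ℂ} (hu : IsBalancedBV u) {c d : α}
    (h : c ≤ d) : IntegrableOn (fun x => S.q.density x *ᵥ u x) (Ico c d) S.q.variation := by
  obtain ⟨K, hK⟩ := locBV_bounded hu.1 c d
  refine Integrable.of_eval fun i => ?_
  simp only [Matrix.mulVec, dotProduct]
  refine integrable_finsetSum _ fun j _ => ?_
  refine Integrable.mul_bdd (c := K) (S.q.integrableOn_density h i j)
    (locBV_measurable hu.1 j).aestronglyMeasurable ?_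
  filter_upwards [ae_restrict_mem measurableSet_Ico] with x hx
  exact (norm_le_pi_norm (u x) j).trans (hK x ⟨hx.1, hx.2.le⟩)

theorem norm_density_mulVec_le (S : System α n) (v : Fin n → ℂ) (i : Fin n) (x : α) :
    ‖(S.w.density x *ᵥ v) i‖ ≤
      2 * (‖S.w.density x i i‖ + ‖star v ⬝ᵥ (S.w.density x *ᵥ v)‖) := by
  have hC := S.w.posSemidef_density S.nonneg_w x
  set C := S.w.density x
  let e : Fin n → ℂ := Pi.single i 1
  have h1 : star e ⬝ᵥ (C *ᵥ v) = (C *ᵥ v) i := by simp [e, Pi.star_single]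
  have h2 : star e ⬝ᵥ (C *ᵥ e) = C i i := by simp [e, Pi.star_single]
  have h3 : star v ⬝ᵥ (C *ᵥ e) = star ((C *ᵥ v) i) := by
    rw [← h1, Matrix.star_dotProduct, Matrix.star_mulVec, hC.1.eq,
      ← Matrix.dotProduct_mulVec]
  have key : ∀ s : ℂ, 0 ≤ (star s * s * C i i + star v ⬝ᵥ (C *ᵥ v) + star s * (C *ᵥ v) i +
      s * star ((C *ᵥ v) i)).re := by
    intro s
    have := (Complex.nonneg_iff.1 (hC.dotProduct_mulVec_nonneg (s • e + v))).1
    rw [Matrix.mulVec_add, Matrix.mulVec_smul, star_add, star_smul, add_dotProduct,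
      dotProduct_add, dotProduct_add, smul_dotProduct, smul_dotProduct, dotProduct_smul,
      dotProduct_smul, h1, h2, h3] at this
    convert this using 2
    simp only [smul_eq_mul]
    ring
  have k1 := key 1
  have k2 := key (-1)
  have k3 := key Complex.I
  have k4 := key (-Complex.I)
  simp at k1 k2 k3 k4
  have b1 := Complex.re_le_norm (C i i)
  have b2 := Complex.re_le_norm (star v ⬝ᵥ (C *ᵥ v))
  have a1 : |((C *ᵥ v) i).re| ≤ ‖C i i‖ + ‖star v ⬝ᵥ (C *ᵥ v)‖ := abs_le.2 ⟨by linarith, by linarith⟩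
  have a2 : |((C *ᵥ v) i).im| ≤ ‖C i i‖ + ‖star v ⬝ᵥ (C *ᵥ v)‖ := abs_le.2 ⟨by linarith, by linarith⟩
  have := Complex.norm_le_abs_re_add_abs_im ((C *ᵥ v) i)
  linarith

theorem integrable_w (S : System α n) {f : α → Fin n → ℂ} (hf : S.MemL2 f) {c d : α}
    (h : c ≤ d) : IntegrableOn (fun x => S.w.density x *ᵥ f x) (Ico c d) S.w.variation := by
  refine Integrable.of_eval fun i => ?_
  have h2 : ∀ i, AEMeasurable (fun x => f x i) S.w.variation := fun i =>
    (measurable_pi_apply i).comp_aemeasurable hf.1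
  have h3 : ∀ i j, AEMeasurable (fun x => S.w.density x i j) S.w.variation := fun i j =>
    (S.w.measurable_density i j).aemeasurable
  refine (((S.w.integrableOn_density h i i).norm.add hf.2.norm.integrableOn).const_mul 2).mono'
    ?_ (Eventually.of_forall fun x => S.norm_density_mulVec_le (f x) i x)
  simp only [Matrix.mulVec, dotProduct]
  exact (by fun_prop : AEMeasurable (fun x => ∑ j, S.w.density x i j * f x j)
    S.w.variation).restrict.aestronglyMeasurable

theorem Solves.add {S : System α n} {u v f g : α → Fin n → ℂ} (hu : IsBalancedBV u)
    (hv : IsBalancedBV v) (hf : S.MemL2 f) (hg : S.MemL2 g) (h1 : S.Solves u f)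
    (h2 : S.Solves v g) : S.Solves (u + v) (f + g) := by
  intro c d h
  have e1 : S.q.integralOn (u + v) (Ico c d) =
      S.q.integralOn u (Ico c d) + S.q.integralOn v (Ico c d) := by
    simp only [MatrixDistribution.integralOn, Pi.add_apply, Matrix.mulVec_add]
    exact integral_add (S.integrable_q hu h) (S.integrable_q hv h)
  have e2 : S.w.integralOn (f + g) (Ico c d) =
      S.w.integralOn f (Ico c d) + S.w.integralOn g (Ico c d) := by
    simp only [MatrixDistribution.integralOn, Pi.add_apply, Matrix.mulVec_add]
    exact integral_add (S.integrable_w hf h) (S.integrable_w hg h)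
  rw [e1, e2, ← h1 c d h, ← h2 c d h, leftLim_add' hu.1 hv.1, leftLim_add' hu.1 hv.1,
    add_sub_add_comm, Matrix.mulVec_add]
  abel

theorem Solves.smul {S : System α n} (k : ℂ) {u f : α → Fin n → ℂ} (hu : IsBalancedBV u)
    (h1 : S.Solves u f) : S.Solves (k • u) (k • f) := by
  intro c d h
  have e : ∀ (M : MatrixDistribution α n) (g : α → Fin n → ℂ),
      M.integralOn (k • g) (Ico c d) = k • M.integralOn g (Ico c d) := by
    intro M g
    simp only [MatrixDistribution.integralOn, Pi.smul_apply, Matrix.mulVec_smul]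
    exact integral_smul _ _
  rw [e, e, ← h1 c d h, leftLim_smul' k hu.1, leftLim_smul' k hu.1, ← smul_sub,
    Matrix.mulVec_smul, smul_add]

theorem Solves.zero (S : System α n) : S.Solves 0 0 := by
  intro c d h
  have h1 : ∀ x, Function.leftLim (0 : α → Fin n → ℂ) x = 0 := fun x =>
    leftLim_eq_of_tendsto tendsto_const_nhds
  simp [h1, MatrixDistribution.integralOn]

/-- Pairs `(u, f)` of functions in `𝓛²(w)` with `u` balanced, of locally bounded variation and
`J u' + q u = w f`. -/
def preTMax (S : System α n) : Submodule ℂ (S.preL2 × S.preL2) where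
  carrier := {p | IsBalancedBV (p.1 : α → Fin n → ℂ) ∧ S.Solves p.1 p.2}
  add_mem' h1 h2 := ⟨h1.1.add h2.1, .add h1.1 h2.1 (Subtype.prop _) (Subtype.prop _) h1.2 h2.2⟩
  zero_mem' := ⟨.zero, .zero S⟩
  smul_mem' k _ h := ⟨h.1.smul k, .smul k h.1 h.2⟩

/-- The maximal relation in `L²(w) × L²(w)`: all pairs of classes `([u], [f])` of the above pairs. -/
def TMax (S : System α n) : Submodule ℂ (S.L2 × S.L2) :=
  S.preTMax.map (S.nullL2.mkQ.prodMap S.nullL2.mkQ)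

/-- `D_z = {([u], z [u]) ∈ T_max}`. -/
def defectSpace (S : System α n) (z : ℂ) : Submodule ℂ (S.L2 × S.L2) where
  carrier := {p | p ∈ S.TMax ∧ p.2 = z • p.1}
  add_mem' h1 h2 := ⟨add_mem h1.1 h2.1, by rw [Prod.snd_add, h1.2, h2.2, Prod.fst_add, smul_add]⟩
  zero_mem' := ⟨zero_mem _, by simp⟩
  smul_mem' k _ h := ⟨Submodule.smul_mem _ k h.1, by
    rw [Prod.smul_snd, h.2, Prod.smul_fst, smul_comm]⟩

/-- The deficiency index `n₊ = dim D_i` of the minimal relation. -/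
noncomputable def nPlus (S : System α n) : Cardinal := Module.rank ℂ (S.defectSpace Complex.I)

/-- The deficiency index `n₋ = dim D_{-i}` of the minimal relation. -/
noncomputable def nMinus (S : System α n) : Cardinal := Module.rank ℂ (S.defectSpace (-Complex.I))

end System

/-- The open interval `(a, b)` with `-∞ ≤ a < b ≤ ∞`. -/
abbrev OpenInterval (a b : EReal) : Set ℝ := {x : ℝ | a < x ∧ (x : EReal) < b}

section Instances
variable (a b : EReal)

instance : OrdConnected (OpenInterval a b) :=
  ⟨fun _ hx _ hy _ hz => ⟨hx.1.trans_le (EReal.coe_le_coe_iff.2 hz.1),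
    (EReal.coe_le_coe_iff.2 hz.2).trans_lt hy.2⟩⟩

instance : NoMinOrder (OpenInterval a b) where
  exists_lt x := by
    obtain ⟨r, h1, h2⟩ := EReal.lt_iff_exists_real_btwn.1 x.2.1
    exact ⟨⟨r, h1, h2.trans x.2.2⟩, EReal.coe_lt_coe_iff.1 h2⟩

instance : NoMaxOrder (OpenInterval a b) where
  exists_gt x := by
    obtain ⟨r, h1, h2⟩ := EReal.lt_iff_exists_real_btwn.1 x.2.2
    exact ⟨⟨r, x.2.1.trans h1, h2⟩, EReal.coe_lt_coe_iff.1 h1⟩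

instance : CompactIccSpace (OpenInterval a b) where
  isCompact_Icc {c d} := by
    rw [Topology.IsInducing.subtypeVal.isCompact_iff]
    have : (Subtype.val '' Icc c d : Set ℝ) = Icc (c : ℝ) d := by
      ext x
      constructor
      · rintro ⟨y, hy, rfl⟩; exact hy
      · intro hx
        exact ⟨⟨x, OrdConnected.out inferInstance c.2 d.2 hx⟩, hx, rfl⟩
    rw [this]
    exact isCompact_Icc

end Instances

end BVSystem

namespace BVSystem

/-! ### Fredholm theory for `1 - G (Q - z W)` in a Hilbert space -/

section Hilbert

variable {H : Type*} [NormedAddCommGroup H] [InnerProductSpace ℂ H]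

open scoped InnerProductSpace

/-- A bounded operator that is at distance less than one from one of finite rank: `1 - K` has
closed range. -/
theorem isClosed_range_one_sub_of_norm_sub_lt_one [CompleteSpace H] (K F : H →L[ℂ] H)
    [FiniteDimensional ℂ F.range] (h : ‖K - F‖ < 1) :
    IsClosed ((1 - K).range : Set H) := by
  -- `1 - (K - F)` is invertible by the Neumann series and agrees with `1 - K` on `ker F`. So `1 -
  -- K` maps this closed subspace of finite codimension onto a closed subspace, and its full range
  -- is a finite-dimensional enlargement of that.
  obtain ⟨U, hU⟩ := isUnit_one_sub_of_norm_lt_one h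
  let e := ContinuousLinearEquiv.unitsEquiv ℂ H U
  have he : ∀ x, e x = x - (K x - F x) := fun x => by
    change (U : H →L[ℂ] H) x = _
    rw [hU]; simp
  have : F.ker.CoFG := by
    rw [Submodule.CoFG]
    exact Module.Finite.equiv F.toLinearMap.quotKerEquivRange.symm
  refine LinearMap.isClosed_range_of_isClosed_map_of_finiteDimensional_quotient (𝕜 := ℂ)
    (s := F.ker) ?_
  have : ((F.ker.map (1 - K : H →L[ℂ] H).toLinearMap : Submodule ℂ H) : Set H) =
      e '' (F.ker : Set H) := by
    rw [Submodule.map_coe]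
    refine Set.image_congr fun x hx => ?_
    have hx' : F x = 0 := hx
    simp [he, hx']
  rw [this]
  exact e.toHomeomorph.isClosedMap _ F.isClosed_ker

variable {G Q W : H →L[ℂ] H}

/-- With `g = Q x - z W x` one has `⟪x, g⟫ = ⟪G g, g⟫`, which is real, as are `⟪x, Q x⟫` and `⟪x, W
x⟫`. Comparing imaginary parts leaves `z.im * ⟪x, W x⟫ = 0`. This is the usual argument that
excludes nonreal eigenvalues; since `W` may be degenerate, only `W x` is seen to vanish, not `x`. -/
theorem apply_eq_zero_of_eq_apply (hG : ∀ x y, ⟪G x, y⟫_ℂ = ⟪x, G y⟫_ℂ)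
    (hQ : ∀ x y, ⟪Q x, y⟫_ℂ = ⟪x, Q y⟫_ℂ) (hW : ∀ x y, ⟪W x, y⟫_ℂ = ⟪x, W y⟫_ℂ)
    (hW0 : ∀ x, ⟪W x, x⟫_ℂ = 0 → W x = 0) {z : ℂ} (hz : z.im ≠ 0) {x : H}
    (hx : x = G (Q x - z • W x)) : W x = 0 := by
  apply hW0
  have real : ∀ {T : H →L[ℂ] H}, (∀ x y, ⟪T x, y⟫_ℂ = ⟪x, T y⟫_ℂ) → ∀ y, (⟪T y, y⟫_ℂ).im = 0 := by
    intro T hT y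
    rw [← Complex.conj_eq_iff_im, inner_conj_symm, hT]
  have h1 : (⟪x, Q x - z • W x⟫_ℂ).im = 0 := by
    have h := real hG (Q x - z • W x)
    rwa [← hx] at h
  rw [inner_sub_right, inner_smul_right, ← hQ, ← hW, Complex.sub_im, real hQ, Complex.mul_im,
    real hW] at h1
  have h2 : (⟪W x, x⟫_ℂ).re = 0 := by simpa [hz] using h1
  exact Complex.ext h2 (real hW x)

/-- The range of `1 - G (Q - z W)` is invariant under conjugation of the nonreal number `z`. -/
theorem mem_range_conj [CompleteSpace H] (hG : ∀ x y, ⟪G x, y⟫_ℂ = ⟪x, G y⟫_ℂ)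
    (hQ : ∀ x y, ⟪Q x, y⟫_ℂ = ⟪x, Q y⟫_ℂ) (hW : ∀ x y, ⟪W x, y⟫_ℂ = ⟪x, W y⟫_ℂ)
    (hW0 : ∀ x, ⟪W x, x⟫_ℂ = 0 → W x = 0)
    (hF : ∀ ε > 0, ∃ F : H →L[ℂ] H, FiniteDimensional ℂ F.range ∧ ‖G - F‖ < ε)
    {z : ℂ} (hz : z.im ≠ 0) {x : H} :
    ∃ y, y - G (Q y - star z • W y) = x - G (Q x - z • W x) := by
  set A := Q - star z • W with hA
  -- This tolerance makes `‖G - F‖ * ‖A‖ < 1`; the `+ 1` covers `A = 0`.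
  obtain ⟨F, hFr, hFn⟩ := hF (1 / (‖A‖ + 1)) (by positivity)
  have hcl : IsClosed ((1 - G ∘L A).range : Set H) := by
    have : FiniteDimensional ℂ (F ∘L A).range :=
      Submodule.finiteDimensional_of_le (LinearMap.range_comp_le_range A.toLinearMap F.toLinearMap)
    refine isClosed_range_one_sub_of_norm_sub_lt_one _ (F ∘L A) ?_
    rw [← ContinuousLinearMap.sub_comp]
    calc _ ≤ ‖G - F‖ * ‖A‖ := ContinuousLinearMap.opNorm_comp_le _ _
      _ ≤ 1 / (‖A‖ + 1) * ‖A‖ := by gcongr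
      _ < 1 := by
        rw [div_mul_eq_mul_div, one_mul, div_lt_one (by positivity)]
        linarith
  have := hcl.completeSpace_coe
  have key : x - G (Q x - z • W x) ∈ (1 - G ∘L A).range := by
    rw [← Submodule.orthogonal_orthogonal (1 - G ∘L A).range]
    refine (Submodule.mem_orthogonal _ _).2 fun g hg => ?_
    -- The adjoint of `1 - G (Q - z̄ W)` is `1 - (Q - z W) G`.
    have hg1 : ∀ y, ⟪y, g⟫_ℂ = ⟪y, Q (G g) - z • W (G g)⟫_ℂ := by
      intro y
      have := (Submodule.mem_orthogonal _ _).1 hg _ ⟨y, rfl⟩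
      simp only [hA, ContinuousLinearMap.coe_coe, _root_.sub_apply,
        one_apply_eq_self, ContinuousLinearMap.comp_apply,
        _root_.smul_apply, inner_sub_left, hG, hQ, hW, inner_smul_left, map_sub,
        map_smul, Complex.conj_conj, Complex.star_def] at this
      rw [inner_sub_right, inner_smul_right, ← sub_eq_zero, ← this]
    have hg2 : g = Q (G g) - z • W (G g) := ext_inner_left ℂ hg1
    -- Applying `G` to `hg2` shows that `G g` is a fixed point of `G (Q - z W)`. Once `W (G g) = 0`,
    -- the equation for `g` no longer contains `z`.
    have hWg : W (G g) = 0 := apply_eq_zero_of_eq_apply hG hQ hW hW0 hz (congrArg G hg2)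
    rw [hWg, smul_zero, sub_zero] at hg2
    rw [inner_sub_right, ← hG, inner_sub_right, inner_smul_right, ← hQ, ← hW, hWg, ← hg2]
    simp
  obtain ⟨y, hy⟩ := key
  exact ⟨y, by simpa [hA] using hy⟩

end Hilbert

end BVSystem

/-! ### Integral operators with bounded operator-valued kernels -/

namespace BVSystem

section Kernel

open MeasureTheory
open scoped InnerProductSpace ENNReal

variable {β E : Type*} [MeasurableSpace β] {μ : Measure β} [IsFiniteMeasure μ]
  [NormedAddCommGroup E] [InnerProductSpace ℂ E] [CompleteSpace E]

/-- A bounded measurable operator-valued kernel. -/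
structure BoundedKernel (β E : Type*) [MeasurableSpace β] [NormedAddCommGroup E]
    [InnerProductSpace ℂ E] where
  toFun : β → β → E →L[ℂ] E
  stronglyMeasurable : StronglyMeasurable (Function.uncurry toFun)
  bound : ℝ
  norm_le : ∀ x t, ‖toFun x t‖ ≤ bound

namespace BoundedKernel

theorem integrable_apply (k : BoundedKernel β E) (x : β) {g : β → E} (hg : Integrable g μ) :
    Integrable (fun t => k.toFun x t (g t)) μ := by
  refine (hg.norm.const_mul k.bound).mono' ?_ (.of_forall fun t => ?_)
  · exact isBoundedBilinearMap_apply.continuous.comp_aestronglyMeasurable₂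
      (k.stronglyMeasurable.comp_measurable measurable_prodMk_left).aestronglyMeasurable hg.1
  · exact ((k.toFun x t).le_opNorm _).trans (by gcongr; exact k.norm_le x t)

theorem stronglyMeasurable_integral (k : BoundedKernel β E) (g : Lp E 2 μ) :
    StronglyMeasurable fun x => ∫ t, k.toFun x t (g t) ∂μ := by
  refine StronglyMeasurable.integral_prod_right (f := fun x t => k.toFun x t (g t)) ?_
  exact isBoundedBilinearMap_apply.continuous.comp_stronglyMeasurable
    (k.stronglyMeasurable.prodMk ((Lp.stronglyMeasurable g).comp_measurable measurable_snd))

/-- The square of the `L²` norm of the kernel. -/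
noncomputable def sqNorm (k : BoundedKernel β E) (μ : Measure β) : ℝ≥0∞ :=
  ∫⁻ x, ∫⁻ t, ‖k.toFun x t‖ₑ ^ (2 : ℝ) ∂μ ∂μ

theorem sqNorm_ne_top (k : BoundedKernel β E) : k.sqNorm μ ≠ ∞ := by
  have h : k.sqNorm μ ≤ ∫⁻ _, ∫⁻ _, ENNReal.ofReal k.bound ^ (2 : ℝ) ∂μ ∂μ := by
    refine lintegral_mono fun x => lintegral_mono fun t => ?_
    gcongr
    rw [← ofReal_norm]
    exact ENNReal.ofReal_le_ofReal (k.norm_le x t)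
  refine ne_top_of_le_ne_top ?_ h
  simp only [lintegral_const]
  exact ENNReal.mul_ne_top (ENNReal.mul_ne_top (by simp) (measure_ne_top _ _))
    (measure_ne_top _ _)

/-- The Hilbert-Schmidt bound: Cauchy-Schwarz in `t` for fixed `x`, then integration over `x`. -/
theorem eLpNorm_integral_le (k : BoundedKernel β E) (g : Lp E 2 μ) :
    eLpNorm (fun x => ∫ t, k.toFun x t (g t) ∂μ) 2 μ ≤
      k.sqNorm μ ^ (1 / 2 : ℝ) * eLpNorm g 2 μ := by
  have hk : ∀ x, AEMeasurable (fun t => ‖k.toFun x t‖ₑ) μ := fun x =>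
    (k.stronglyMeasurable.comp_measurable measurable_prodMk_left).enorm.aemeasurable
  have hg : AEMeasurable (fun t => ‖g t‖ₑ) μ := (Lp.stronglyMeasurable g).enorm.aemeasurable
  have key : ∀ x, ‖∫ t, k.toFun x t (g t) ∂μ‖ₑ ^ (2 : ℝ) ≤
      (∫⁻ t, ‖k.toFun x t‖ₑ ^ (2 : ℝ) ∂μ) * ∫⁻ t, ‖g t‖ₑ ^ (2 : ℝ) ∂μ := by
    intro x
    calc ‖∫ t, k.toFun x t (g t) ∂μ‖ₑ ^ (2 : ℝ)
        ≤ (∫⁻ t, ‖k.toFun x t‖ₑ * ‖g t‖ₑ ∂μ) ^ (2 : ℝ) := by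
          gcongr
          refine (enorm_integral_le_lintegral_enorm _).trans (lintegral_mono fun t => ?_)
          exact (k.toFun x t).le_opENorm _
      _ ≤ ((∫⁻ t, ‖k.toFun x t‖ₑ ^ (2 : ℝ) ∂μ) ^ (1 / 2 : ℝ) *
            (∫⁻ t, ‖g t‖ₑ ^ (2 : ℝ) ∂μ) ^ (1 / 2 : ℝ)) ^ (2 : ℝ) := by
          gcongr
          exact ENNReal.lintegral_mul_le_Lp_mul_Lq μ Real.HolderConjugate.two_two (hk x) hg
      _ = _ := by
          rw [ENNReal.mul_rpow_of_nonneg _ _ (by norm_num), ← ENNReal.rpow_mul,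
            ← ENNReal.rpow_mul]
          norm_num
  rw [eLpNorm_eq_lintegral_rpow_enorm_toReal (by norm_num) (by norm_num),
    eLpNorm_eq_lintegral_rpow_enorm_toReal (by norm_num) (by norm_num), ENNReal.toReal_ofNat,
    ← ENNReal.mul_rpow_of_nonneg _ _ (by norm_num)]
  gcongr
  calc _ ≤ ∫⁻ x, (∫⁻ t, ‖k.toFun x t‖ₑ ^ (2 : ℝ) ∂μ) * ∫⁻ t, ‖g t‖ₑ ^ (2 : ℝ) ∂μ ∂μ :=
        lintegral_mono key
    _ = _ := by
      rw [lintegral_mul_const, sqNorm]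
      exact Measurable.lintegral_prod_right (f := fun x t => ‖k.toFun x t‖ₑ ^ (2 : ℝ))
        (k.stronglyMeasurable.enorm.pow_const _)

theorem memLp_integral (k : BoundedKernel β E) (g : Lp E 2 μ) :
    MemLp (fun x => ∫ t, k.toFun x t (g t) ∂μ) 2 μ :=
  ⟨(k.stronglyMeasurable_integral g).aestronglyMeasurable, (k.eLpNorm_integral_le g).trans_lt
    (ENNReal.mul_lt_top (ENNReal.rpow_lt_top_of_nonneg (by norm_num) k.sqNorm_ne_top)
      (Lp.memLp g).2)⟩

variable (μ) in
/-- The integral operator with a given kernel. -/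
noncomputable def operator (k : BoundedKernel β E) : Lp E 2 μ →L[ℂ] Lp E 2 μ :=
  LinearMap.mkContinuous
    { toFun := fun g => (k.memLp_integral g).toLp
      map_add' := fun f g => by
        rw [← MemLp.toLp_add]
        refine MemLp.toLp_congr _ _ (.of_forall fun x => ?_)
        have hf := k.integrable_apply x ((Lp.memLp f).integrable (by norm_num))
        have hg := k.integrable_apply x ((Lp.memLp g).integrable (by norm_num))
        simp only [Pi.add_apply]
        rw [← integral_add hf hg]
        refine integral_congr_ae ?_
        filter_upwards [Lp.coeFn_add f g] with t ht
        rw [ht, Pi.add_apply, map_add]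
      map_smul' := fun c g => by
        rw [RingHom.id_apply, ← MemLp.toLp_const_smul]
        refine MemLp.toLp_congr _ _ (.of_forall fun x => ?_)
        simp only [Pi.smul_apply]
        rw [← integral_smul]
        refine integral_congr_ae ?_
        filter_upwards [Lp.coeFn_smul c g] with t ht
        rw [ht, Pi.smul_apply, map_smul] }
    (k.sqNorm μ ^ (1 / 2 : ℝ)).toReal
    (fun g => by
      simp only [LinearMap.coe_mk, AddHom.coe_mk, Lp.norm_toLp]
      rw [Lp.norm_def, ← ENNReal.toReal_mul]
      exact ENNReal.toReal_mono (ENNReal.mul_ne_top (ENNReal.rpow_ne_top_of_nonneg (by norm_num)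
        k.sqNorm_ne_top) (Lp.eLpNorm_ne_top g)) (k.eLpNorm_integral_le g))

theorem coeFn_operator (k : BoundedKernel β E) (g : Lp E 2 μ) :
    k.operator μ g =ᵐ[μ] fun x => ∫ t, k.toFun x t (g t) ∂μ :=
  (k.memLp_integral g).coeFn_toLp

theorem norm_operator_le (k : BoundedKernel β E) :
    ‖k.operator μ‖ ≤ (k.sqNorm μ ^ (1 / 2 : ℝ)).toReal :=
  LinearMap.mkContinuous_norm_le _ ENNReal.toReal_nonneg _

/-- The difference of two kernels. -/
@[simps]
def sub (k l : BoundedKernel β E) : BoundedKernel β E where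
  toFun x t := k.toFun x t - l.toFun x t
  stronglyMeasurable := k.stronglyMeasurable.sub l.stronglyMeasurable
  bound := k.bound + l.bound
  norm_le x t := (norm_sub_le _ _).trans (add_le_add (k.norm_le x t) (l.norm_le x t))

theorem operator_sub (k l : BoundedKernel β E) :
    (k.sub l).operator μ = k.operator μ - l.operator μ := by
  ext1 g
  refine Lp.ext ?_
  filter_upwards [(k.sub l).coeFn_operator g, k.coeFn_operator g, l.coeFn_operator g,
    Lp.coeFn_sub (k.operator μ g) (l.operator μ g)] with x h1 h2 h3 h4
  rw [_root_.sub_apply, h1, h4, Pi.sub_apply, h2, h3, ← integral_sub]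
  · rfl
  · exact k.integrable_apply x ((Lp.memLp g).integrable (by norm_num))
  · exact l.integrable_apply x ((Lp.memLp g).integrable (by norm_num))

/-- Fubini. It applies because the kernel is bounded and, on a finite measure space, square
integrable functions are integrable. -/
theorem inner_operator (k : BoundedKernel β E)
    (hk : ∀ x t u v, ⟪k.toFun x t u, v⟫_ℂ = ⟪u, k.toFun t x v⟫_ℂ) (f g : Lp E 2 μ) :
    ⟪k.operator μ f, g⟫_ℂ = ⟪f, k.operator μ g⟫_ℂ := by
  have hf : Integrable f μ := (Lp.memLp f).integrable (by norm_num)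
  have hg : Integrable g μ := (Lp.memLp g).integrable (by norm_num)
  rw [L2.inner_def, L2.inner_def]
  have e1 : ∫ x, ⟪k.operator μ f x, g x⟫_ℂ ∂μ = ∫ x, ∫ t, ⟪k.toFun x t (f t), g x⟫_ℂ ∂μ ∂μ := by
    refine integral_congr_ae ?_
    filter_upwards [k.coeFn_operator f] with x hx
    rw [hx, ← inner_conj_symm, ← integral_inner (k.integrable_apply x hf), ← integral_conj]
    simp only [inner_conj_symm]
  have e2 : ∫ t, ⟪f t, k.operator μ g t⟫_ℂ ∂μ = ∫ t, ∫ x, ⟪k.toFun x t (f t), g x⟫_ℂ ∂μ ∂μ := by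
    refine integral_congr_ae ?_
    filter_upwards [k.coeFn_operator g] with x hx
    rw [hx, ← integral_inner (k.integrable_apply x hg)]
    simp only [hk]
  rw [e1, e2]
  refine integral_integral_swap ?_
  refine ((hg.norm.mul_prod hf.norm).const_mul k.bound).mono' ?_ (.of_forall fun p => ?_)
  · refine StronglyMeasurable.aestronglyMeasurable ?_
    refine StronglyMeasurable.inner ?_ ?_
    · exact isBoundedBilinearMap_apply.continuous.comp_stronglyMeasurable
        (k.stronglyMeasurable.prodMk ((Lp.stronglyMeasurable f).comp_measurable measurable_snd))
    · exact (Lp.stronglyMeasurable g).comp_measurable measurable_fst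
  · calc ‖⟪k.toFun p.1 p.2 (f p.2), g p.1⟫_ℂ‖ ≤ ‖k.toFun p.1 p.2 (f p.2)‖ * ‖g p.1‖ :=
          norm_inner_le_norm _ _
      _ ≤ (k.bound * ‖f p.2‖) * ‖g p.1‖ := by
          gcongr
          exact ((k.toFun p.1 p.2).le_opNorm _).trans (by gcongr; exact k.norm_le _ _)
      _ = _ := by ring

/-- A kernel that takes finitely many values as a function of the first variable gives an operator
of finite rank. -/
theorem finiteDimensional_range_operator [FiniteDimensional ℂ E] (k : BoundedKernel β E) {N : ℕ}
    {p : β → Fin N} (hp : Measurable p) {κ : Fin N → β → E →L[ℂ] E}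
    (h : ∀ x t, k.toFun x t = κ (p x) t) : FiniteDimensional ℂ (k.operator μ).range := by
  have hm : ∀ v : Fin N → E, MemLp (fun x => v (p x)) 2 μ := fun v =>
    MemLp.of_bound (StronglyMeasurable.of_discrete.comp_measurable hp).aestronglyMeasurable
      ‖v‖ (.of_forall fun x => norm_le_pi_norm v _)
  -- Every image under the operator is constant on the level sets of `p`, so it is determined by one
  -- vector of `E` for each value of `p`.
  let Φ : (Fin N → E) →ₗ[ℂ] Lp E 2 μ :=
    { toFun := fun v => (hm v).toLp
      map_add' := fun v w => (MemLp.toLp_add (hm v) (hm w)).symm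
      map_smul' := fun c v => (MemLp.toLp_const_smul c (hm v)).symm }
  refine Submodule.finiteDimensional_of_le (S₂ := LinearMap.range Φ) ?_
  rintro _ ⟨g, rfl⟩
  refine ⟨fun i => ∫ t, κ i t (g t) ∂μ, Lp.ext ?_⟩
  change ((hm fun i => ∫ t, κ i t (g t) ∂μ).toLp : β → E) =ᵐ[μ] _
  refine (MemLp.coeFn_toLp _).trans ((k.coeFn_operator g).trans ?_).symm
  refine .of_forall fun x => ?_
  simp only [h]

end BoundedKernel

end Kernel

end BVSystem

/-! ### The sign kernel: symmetry and approximation by finite rank -/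

namespace BVSystem
open MeasureTheory Set Topology Filter
open scoped ComplexOrder Matrix

section SignKernel

open scoped InnerProductSpace ENNReal

variable {α : Type} [LinearOrder α] [DenselyOrdered α] [NoMinOrder α] [NoMaxOrder α]
  [TopologicalSpace α] [OrderTopology α] [SecondCountableTopology α] [CompactIccSpace α]
  [MeasurableSpace α] [BorelSpace α]
  {E : Type*} [NormedAddCommGroup E] [InnerProductSpace ℂ E] [CompleteSpace E]

/-- Half of the sign of `x - t`. -/
noncomputable def halfSign {γ : Type*} [LinearOrder γ] (x t : γ) : ℂ :=
  if t < x then 2⁻¹ else if x < t then -2⁻¹ else 0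

theorem norm_halfSign_le {γ : Type*} [LinearOrder γ] (x t : γ) : ‖halfSign x t‖ ≤ 1 := by
  unfold halfSign
  split_ifs <;> norm_num

theorem halfSign_swap {γ : Type*} [LinearOrder γ] (x t : γ) : halfSign t x = -halfSign x t := by
  rcases lt_trichotomy x t with h | h | h <;> simp [halfSign, h, h.not_gt]

theorem conj_halfSign {γ : Type*} [LinearOrder γ] (x t : γ) :
    (starRingEnd ℂ) (halfSign x t) = halfSign x t := by
  unfold halfSign
  split_ifs <;> simp [map_ofNat]

/-- The kernel `sign (p x - p t) / 2 • L`. -/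
@[simps]
noncomputable def signKernel {γ : Type*} [LinearOrder γ] {p : α → γ}
    (hp : MeasurableSet {z : α × α | p z.1 < p z.2}) (L : E →L[ℂ] E) : BoundedKernel α E where
  toFun x t := halfSign (p x) (p t) • L
  stronglyMeasurable := by
    have h' : MeasurableSet {z : α × α | p z.2 < p z.1} := measurable_swap hp
    refine StronglyMeasurable.smul_const (f := fun z : α × α => halfSign (p z.1) (p z.2)) ?_ L
    exact StronglyMeasurable.ite h' stronglyMeasurable_const
      (StronglyMeasurable.ite hp stronglyMeasurable_const stronglyMeasurable_const)
  bound := ‖L‖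
  norm_le x t := by
    rw [norm_smul]
    exact mul_le_of_le_one_left (norm_nonneg _) (norm_halfSign_le _ _)

theorem measurableSet_fst_lt_snd : MeasurableSet {z : α × α | id z.1 < id z.2} :=
  measurableSet_lt measurable_fst measurable_snd

/-- Two minus signs cancel: the scalar factor is antisymmetric under exchange of `x` and `t`, and
`L` is skew. -/
theorem inner_signKernel_operator {μ : Measure α} [IsFiniteMeasure μ] {L : E →L[ℂ] E}
    (hL : ∀ u v, ⟪L u, v⟫_ℂ = -⟪u, L v⟫_ℂ) (f g : Lp E 2 μ) :
    ⟪(signKernel measurableSet_fst_lt_snd L).operator μ f, g⟫_ℂ =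
      ⟪f, (signKernel measurableSet_fst_lt_snd L).operator μ g⟫_ℂ := by
  refine BoundedKernel.inner_operator _ (fun x t u v => ?_) f g
  simp only [signKernel_toFun, _root_.smul_apply, inner_smul_left, inner_smul_right, hL,
    conj_halfSign, id]
  rw [halfSign_swap x t]
  ring

/-- The integral operator with kernel `sign (x - t) / 2 • L` is a limit of operators of finite
rank. -/
theorem exists_finiteRank_signKernel [FiniteDimensional ℂ E] (μ : Measure α) [IsFiniteMeasure μ]
    (L : E →L[ℂ] E) {ε : ℝ} (hε : 0 < ε) :
    ∃ F : Lp E 2 μ →L[ℂ] Lp E 2 μ, FiniteDimensional ℂ F.range ∧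
      ‖(signKernel measurableSet_fst_lt_snd L).operator μ - F‖ < ε := by
  rcases isEmpty_or_nonempty α with hα | hα
  · refine ⟨0, ?_, ?_⟩
    · rw [show (0 : Lp E 2 μ →L[ℂ] Lp E 2 μ).range = ⊥ from LinearMap.range_zero]
      infer_instance
    · have : (signKernel measurableSet_fst_lt_snd L).operator μ = 0 := by
        ext1 g
        exact Lp.ext (.of_forall fun x => hα.elim x)
      simpa [this] using hε
  let d : ℕ → α := TopologicalSpace.denseSeq α
  -- The number of the first `m` points of a dense sequence that lie strictly to the left of `x`.
  -- Replacing `x` and `t` by their counts gives kernels of finite rank, and two distinct points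
  -- have distinct counts as soon as a point of the sequence falls between them.
  let p (m : ℕ) (x : α) : Fin (m + 1) :=
    ⟨((Finset.range m).filter fun j => d j < x).card,
      Nat.lt_succ_of_le ((Finset.card_filter_le _ _).trans (by simp))⟩
  have hpm : ∀ m, Monotone (p m) := fun m x y h => by
    rw [Fin.mk_le_mk]
    refine Finset.card_le_card fun j hj => ?_
    rw [Finset.mem_filter] at hj ⊢
    exact ⟨hj.1, hj.2.trans_le h⟩
  have hpmeas : ∀ m, Measurable (p m) := fun m => by
    have : Measurable fun x => (p m x : ℕ) := by
      simp only [p, Finset.card_filter]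
      exact Finset.measurable_fun_sum _ fun j _ =>
        Measurable.ite measurableSet_Ioi measurable_const measurable_const
    refine measurable_to_countable' fun i => ?_
    have h2 : p m ⁻¹' {i} = (fun x => (p m x : ℕ)) ⁻¹' {(i : ℕ)} := by
      ext x; simp [Fin.ext_iff]
    rw [h2]
    exact this (measurableSet_singleton _)
  have hpset : ∀ m, MeasurableSet {z : α × α | p m z.1 < p m z.2} := fun m => by
    have h : Measurable fun z : α × α => (p m z.1, p m z.2) :=
      ((hpmeas m).comp measurable_fst).prodMk ((hpmeas m).comp measurable_snd)
    exact h (MeasurableSet.of_discrete (s := {z : Fin (m + 1) × Fin (m + 1) | z.1 < z.2}))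
  have hstep : ∀ x t, t < x → ∀ᶠ m in atTop, p m t < p m x := by
    intro x t h
    obtain ⟨j, hj⟩ := (TopologicalSpace.denseRange_denseSeq α).exists_mem_open isOpen_Ioo
      (nonempty_Ioo.2 h)
    filter_upwards [eventually_gt_atTop j] with m hm
    rw [Fin.mk_lt_mk]
    refine Finset.card_lt_card ⟨fun i hi => ?_, fun hsub => ?_⟩
    · rw [Finset.mem_filter] at hi ⊢
      exact ⟨hi.1, hi.2.trans h⟩
    · have := hsub (Finset.mem_filter.2 ⟨Finset.mem_range.2 hm, hj.2⟩)
      exact lt_asymm hj.1 (Finset.mem_filter.1 this).2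
  have hlim : ∀ x t, ∀ᶠ m in atTop, halfSign (p m x) (p m t) = halfSign x t := by
    intro x t
    rcases lt_trichotomy x t with h | h | h
    · filter_upwards [hstep t x h] with m hm
      simp [halfSign, h, hm, h.not_gt, hm.not_gt]
    · subst h
      exact .of_forall fun m => by simp [halfSign]
    · filter_upwards [hstep x t h] with m hm
      simp [halfSign, h, hm]
  let k := signKernel (α := α) measurableSet_fst_lt_snd L
  let k' (m : ℕ) := signKernel (hpset m) L
  -- At each pair of points the kernels eventually coincide, the diagonal included; dominated
  -- convergence on the finite product measure gives convergence in Hilbert-Schmidt norm.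
  have htend : Tendsto (fun m => (k.sub (k' m)).sqNorm μ) atTop (𝓝 0) := by
    have e : ∀ m, (k.sub (k' m)).sqNorm μ =
        ∫⁻ z, ‖(k.sub (k' m)).toFun z.1 z.2‖ₑ ^ (2 : ℝ) ∂(μ.prod μ) := fun m => by
      rw [lintegral_prod]
      · rfl
      · exact ((k.sub (k' m)).stronglyMeasurable.enorm.pow_const _).aemeasurable
    simp only [e]
    have h0 : ∫⁻ _ : α × α, (0 : ℝ≥0∞) ∂(μ.prod μ) = 0 := by simp
    rw [← h0]
    refine tendsto_lintegral_of_dominated_convergence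
      (fun _ => ENNReal.ofReal (‖L‖ + ‖L‖) ^ (2 : ℝ)) ?_ ?_ ?_ ?_
    · exact fun m => (k.sub (k' m)).stronglyMeasurable.enorm.pow_const _
    · refine fun m => .of_forall fun z => ?_
      beta_reduce
      gcongr
      rw [← ofReal_norm]
      exact ENNReal.ofReal_le_ofReal ((k.sub (k' m)).norm_le _ _)
    · rw [lintegral_const]
      exact ENNReal.mul_ne_top (by simp) (measure_ne_top _ _)
    · refine .of_forall fun z => tendsto_const_nhds.congr' ?_
      filter_upwards [hlim z.1 z.2] with m hm
      simp [k, k', hm]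
  have htend2 : Tendsto (fun m => ((k.sub (k' m)).sqNorm μ ^ (1 / 2 : ℝ)).toReal) atTop (𝓝 0) := by
    have := (ENNReal.continuous_rpow_const (y := 1 / 2)).tendsto 0 |>.comp htend
    rw [ENNReal.zero_rpow_of_pos (by norm_num)] at this
    exact (ENNReal.tendsto_toReal ENNReal.zero_ne_top).comp this
  obtain ⟨m, hm⟩ := (htend2.eventually (gt_mem_nhds hε)).exists
  refine ⟨(k' m).operator μ, ?_, ?_⟩
  · exact (k' m).finiteDimensional_range_operator (hpmeas m)
      (κ := fun i t => halfSign i (p m t) • L) fun x t => rfl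
  · rw [← BoundedKernel.operator_sub]
    exact (BoundedKernel.norm_operator_le _).trans_lt hm

end SignKernel

end BVSystem

/-! ### Finiteness of `|dM|`, and bounds and symmetry of its density -/

namespace BVSystem
open MeasureTheory Set Topology Filter
open scoped ComplexOrder Matrix

namespace MatrixDistribution

open scoped InnerProductSpace

variable {α : Type} [LinearOrder α] [DenselyOrdered α] [NoMinOrder α] [NoMaxOrder α]
  [TopologicalSpace α] [OrderTopology α] [SecondCountableTopology α] [CompactIccSpace α]
  [MeasurableSpace α] [BorelSpace α] {n : ℕ}

/-- The variation function is bounded by the sum of the total variations of the entries, wherever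
its base point lies. Its right-continuous version is bounded too, so it has finite limits at both
ends, and their difference is the total mass. -/
theorem isFiniteMeasure_variation (M : MatrixDistribution α n)
    (h : ∀ i j, BoundedVariationOn (fun x => M.antideriv x i j) univ) :
    IsFiniteMeasure M.variation := by
  rcases isEmpty_or_nonempty α with hα | hα
  · exact ⟨by rw [univ_eq_empty_iff.2 hα]; simp⟩
  have hb : ∀ x, |M.variationFun x| ≤
      ∑ i, ∑ j, (eVariationOn (fun x => M.antideriv x i j) univ).toReal := fun x => by
    refine (Finset.abs_sum_le_sum_abs _ _).trans (Finset.sum_le_sum fun i _ => ?_)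
    refine (Finset.abs_sum_le_sum_abs _ _).trans (Finset.sum_le_sum fun j _ => ?_)
    unfold variationOnFromTo
    split_ifs
    · rw [abs_of_nonneg ENNReal.toReal_nonneg]
      exact ENNReal.toReal_mono (h i j) (eVariationOn.mono _ inter_subset_left)
    · rw [abs_neg, abs_of_nonneg ENNReal.toReal_nonneg]
      exact ENNReal.toReal_mono (h i j) (eVariationOn.mono _ inter_subset_left)
  set K := ∑ i, ∑ j, (eVariationOn (fun x => M.antideriv x i j) univ).toReal
  have hst : ∀ x, |M.variationFun_mono.stieltjesFunction x| ≤ K := fun x => by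
    obtain ⟨y, hy⟩ := exists_gt x
    refine abs_le.2 ⟨?_, ?_⟩
    · exact (abs_le.1 (hb x)).1.trans (M.variationFun_mono.le_rightLim le_rfl)
    · exact (M.variationFun_mono.rightLim_le hy).trans (abs_le.1 (hb y)).2
  have hl := tendsto_atBot_ciInf M.variationFun_mono.stieltjesFunction.mono
    ⟨-K, by rintro _ ⟨x, rfl⟩; exact (abs_le.1 (hst x)).1⟩
  have hu := tendsto_atTop_ciSup M.variationFun_mono.stieltjesFunction.mono
    ⟨K, by rintro _ ⟨x, rfl⟩; exact (abs_le.1 (hst x)).2⟩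
  exact ⟨by rw [variation, StieltjesFunction.measure_univ _ hl hu]; exact ENNReal.ofReal_lt_top⟩

/-- For `|s| = 1` the function `variationFun - Re (s M i j)` is increasing, so its density `1 - Re
(s A i j)` is non-negative almost everywhere. The choices `s = ±1, ±I` bound the real and imaginary
parts by `1`, hence the crude constant `2`. -/
theorem ae_norm_density_le (M : MatrixDistribution α n) (i j : Fin n) :
    ∀ᵐ x ∂M.variation, ‖M.density x i j‖ ≤ 2 := by
  have key : ∀ s : ℂ, ‖s‖ = 1 → ∀ᵐ x ∂M.variation, 0 ≤ 1 - (s * M.density x i j).re := by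
    intro s hs
    refine ae_nonneg_of_Ico (F := fun x => M.variationFun x - (s * M.antideriv x i j).re) ?_ ?_ ?_
      ?_
    · exact measurable_const.sub (Complex.measurable_re.comp
        ((M.measurable_density i j).const_mul s))
    · intro c d h
      have h1 := (Complex.re_le_norm (s * (M.antideriv d i j - M.antideriv c i j))).trans_eq
        (norm_mul _ _)
      rw [hs, one_mul, mul_sub, Complex.sub_re] at h1
      have h2 := M.norm_entry_sub_le i j h
      dsimp only
      linarith
    · exact fun x => (M.variationFun_leftCont x).sub (Complex.continuous_re.continuousAt
        |>.comp_continuousWithinAt (continuousWithinAt_const.mul (M.entry_leftCont i j x)))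
    · intro c d h
      have hv : M.variation (Ico c d) = ENNReal.ofReal (M.variationFun d - M.variationFun c) :=
        stieltjes_Ico M.variationFun_mono M.variationFun_leftCont c d
      have i1 : IntegrableOn (fun _ => (1 : ℝ)) (Ico c d) M.variation := by
        simp [integrableOn_const_iff, hv]
      have i2 := (M.integrableOn_density h i j).const_mul s
      refine ⟨i1.sub i2.re, ?_⟩
      have e := Complex.reCLM.integral_comp_comm i2
      simp only [Complex.reCLM_apply] at e
      have e2 := integral_sub i1 i2.re
      simp only [RCLike.re_to_complex] at e2
      rw [e2, e, integral_const_mul, M.integral_density h]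
      simp only [integral_const, measureReal_restrict_apply MeasurableSet.univ, univ_inter,
        measureReal_def, hv, ENNReal.toReal_ofReal (sub_nonneg.2 (M.variationFun_mono h)),
        smul_eq_mul, mul_one, mul_sub, Complex.sub_re]
      ring
  filter_upwards [key 1 (by simp), key (-1) (by simp), key Complex.I (by simp),
    key (-Complex.I) (by simp)] with x h1 h2 h3 h4
  simp at h1 h2 h3 h4
  have a1 : |(M.density x i j).re| ≤ 1 := abs_le.2 ⟨by linarith, by linarith⟩
  have a2 : |(M.density x i j).im| ≤ 1 := abs_le.2 ⟨by linarith, by linarith⟩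
  have := Complex.norm_le_abs_re_add_abs_im (M.density x i j)
  linarith

/-- The entries of `A - Aᴴ` integrate to zero over every half-open interval. Comparison with the
constant primitive `0` makes the real part of each multiple by `s` non-negative almost everywhere,
and `s = ±1, ±I` together force the entries to vanish. -/
theorem ae_isHermitian_density (M : MatrixDistribution α n) (hM : M.IsHermitian) :
    ∀ᵐ x ∂M.variation, (M.density x).IsHermitian := by
  have key : ∀ (i j : Fin n) (s : ℂ), ∀ᵐ x ∂M.variation,
      0 ≤ (s * (M.density x i j - star (M.density x j i))).re := by
    intro i j s
    refine ae_nonneg_of_Ico (F := fun x => 0) ?_ monotone_const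
      (fun x => continuousWithinAt_const) ?_
    · exact Complex.measurable_re.comp (((M.measurable_density i j).sub
        (Complex.continuous_conj.measurable.comp (M.measurable_density j i))).const_mul s)
    · intro c d h
      have i1 := M.integrableOn_density h i j
      have i2 : IntegrableOn (fun x => star (M.density x j i)) (Ico c d) M.variation :=
        Complex.conjCLE.toContinuousLinearMap.integrable_comp (M.integrableOn_density h j i)
      have i3 := (i1.sub i2).const_mul s
      refine ⟨i3.re, ?_⟩
      have e := Complex.reCLM.integral_comp_comm i3
      simp only [Complex.reCLM_apply, Pi.sub_apply] at e
      rw [e, integral_const_mul, integral_sub i1 i2]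
      have e2 : ∫ x in Ico c d, star (M.density x j i) ∂M.variation =
          star (∫ x in Ico c d, M.density x j i ∂M.variation) := integral_conj
      rw [e2, M.integral_density h, M.integral_density h]
      have := congrFun (congrFun (hM c d h) i) j
      simp only [Matrix.conjTranspose_apply, Matrix.sub_apply] at this
      rw [this]
      simp
  have h := fun i j => (key i j 1).and ((key i j (-1)).and
    ((key i j Complex.I).and (key i j (-Complex.I))))
  simp only [← ae_all_iff] at h
  filter_upwards [h] with x hx
  ext i j
  rw [Matrix.conjTranspose_apply]
  obtain ⟨h1, h2, h3, h4⟩ := hx i j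
  simp at h1 h2 h3 h4
  apply Complex.ext <;> simp <;> linarith

end MatrixDistribution

end BVSystem

/-! ### Densities with respect to a dominating finite measure -/

namespace BVSystem
open MeasureTheory Set Topology Filter
open scoped ComplexOrder Matrix

namespace MatrixDistribution

open scoped InnerProductSpace ENNReal

variable {α : Type} [LinearOrder α] [DenselyOrdered α] [NoMinOrder α] [NoMaxOrder α]
  [TopologicalSpace α] [OrderTopology α] [SecondCountableTopology α] [CompactIccSpace α]
  [MeasurableSpace α] [BorelSpace α] {n : ℕ}

/-- The density of `dM` with respect to a measure `μ` that dominates `|dM|`, as an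
operator on `ℂⁿ`. -/
noncomputable def relDensity (M : MatrixDistribution α n) (μ : Measure α) (x : α) :
    EuclideanSpace ℂ (Fin n) →L[ℂ] EuclideanSpace ℂ (Fin n) :=
  (M.variation.rnDeriv μ x).toReal • Matrix.toEuclideanCLM (𝕜 := ℂ) (M.density x)

theorem ofLp_relDensity (M : MatrixDistribution α n) (μ : Measure α) (x : α)
    (v : EuclideanSpace ℂ (Fin n)) :
    (M.relDensity μ x v).ofLp =
      (M.variation.rnDeriv μ x).toReal • (M.density x *ᵥ v.ofLp) := rfl

theorem relDensity_eq_zero (M : MatrixDistribution α n) {μ : Measure α} {x : α}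
    (h : (M.variation.rnDeriv μ x).toReal = 0) : M.relDensity μ x = 0 := by
  rw [relDensity, h]
  exact zero_smul ℝ (Matrix.toEuclideanCLM (𝕜 := ℂ) (M.density x) :
    EuclideanSpace ℂ (Fin n) →L[ℂ] EuclideanSpace ℂ (Fin n))

theorem stronglyMeasurable_toEuclideanCLM_density (M : MatrixDistribution α n) :
    StronglyMeasurable fun x => Matrix.toEuclideanCLM (𝕜 := ℂ) (M.density x) := by
  have e : ∀ x, Matrix.toEuclideanCLM (𝕜 := ℂ) (M.density x) =
      ∑ i, ∑ j, M.density x i j • Matrix.toEuclideanCLM (𝕜 := ℂ) (Matrix.single i j (1 : ℂ)) := by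
    intro x
    conv_lhs => rw [Matrix.matrix_eq_sum_single (M.density x)]
    simp only [map_sum, ← map_smul, Matrix.smul_single, smul_eq_mul, mul_one]
  simp only [e]
  refine Finset.stronglyMeasurable_fun_sum _ fun i _ => Finset.stronglyMeasurable_fun_sum _
    fun j _ => ?_
  exact (M.measurable_density i j).stronglyMeasurable.smul_const _

theorem stronglyMeasurable_relDensity (M : MatrixDistribution α n) (μ : Measure α) :
    StronglyMeasurable (M.relDensity μ) :=
  (Measure.measurable_rnDeriv _ _).ennreal_toReal.stronglyMeasurable.smul
    M.stronglyMeasurable_toEuclideanCLM_density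

/-- Almost everywhere the density lies in the compact set of matrices with entries of modulus at
most `2`, on which the operator norm is bounded by continuity. -/
theorem exists_ae_norm_toEuclideanCLM_density_le (M : MatrixDistribution α n) :
    ∃ C : ℝ, ∀ᵐ x ∂M.variation, ‖Matrix.toEuclideanCLM (𝕜 := ℂ) (M.density x)‖ ≤ C := by
  let Φ : Matrix (Fin n) (Fin n) ℂ →ₗ[ℂ] (EuclideanSpace ℂ (Fin n) →L[ℂ] EuclideanSpace ℂ (Fin n)) :=
    (Matrix.toEuclideanCLM (n := Fin n) (𝕜 := ℂ)).toAlgEquiv.toLinearMap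
  let K : Set (Matrix (Fin n) (Fin n) ℂ) :=
    Set.pi univ fun _ => Set.pi univ fun _ => Metric.closedBall 0 2
  have hK : IsCompact K := isCompact_univ_pi fun _ => isCompact_univ_pi fun _ =>
    isCompact_closedBall _ _
  obtain ⟨C, hC⟩ := hK.exists_bound_of_continuousOn
    (LinearMap.continuous_of_finiteDimensional Φ).continuousOn
  refine ⟨C, ?_⟩
  filter_upwards [ae_all_iff.2 fun i => ae_all_iff.2 fun j => M.ae_norm_density_le i j] with x hx
  exact hC _ fun i _ j _ => by simpa using hx i j

section

variable {μ : Measure α} [IsFiniteMeasure μ]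

theorem ae_rnDeriv_le_one {ν : Measure α} (h : ν ≤ μ) :
    ∀ᵐ x ∂μ, ν.rnDeriv μ x ≤ 1 := by
  refine ae_le_of_forall_setLIntegral_le_of_sigmaFinite (Measure.measurable_rnDeriv _ _)
    fun s hs _ => ?_
  rw [setLIntegral_const, one_mul]
  exact (Measure.setLIntegral_rnDeriv_le s).trans (h s)

/-- A property of the density that is valid almost everywhere for `|dM|` is valid almost everywhere
for `μ` where the relative density does not vanish. -/
theorem ae_rnDeriv_imp (M : MatrixDistribution α n) (h : M.variation ≤ μ) {p : α → Prop}
    (hp : ∀ᵐ x ∂M.variation, p x) :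
    ∀ᵐ x ∂μ, (M.variation.rnDeriv μ x).toReal ≠ 0 → p x := by
  have : IsFiniteMeasure M.variation := isFiniteMeasure_of_le μ h
  rw [← Measure.withDensity_rnDeriv_eq _ _ (Measure.absolutelyContinuous_of_le h),
    ae_withDensity_iff (Measure.measurable_rnDeriv _ _)] at hp
  filter_upwards [hp] with x hx h0
  exact hx fun h1 => h0 (by rw [h1, ENNReal.toReal_zero])

theorem exists_ae_norm_relDensity_le (M : MatrixDistribution α n) (h : M.variation ≤ μ) :
    ∃ C : ℝ, ∀ᵐ x ∂μ, ‖M.relDensity μ x‖ ≤ C := by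
  obtain ⟨C, hC⟩ := M.exists_ae_norm_toEuclideanCLM_density_le
  refine ⟨max C 0, ?_⟩
  filter_upwards [M.ae_rnDeriv_imp h hC, ae_rnDeriv_le_one h] with x h1 h2
  by_cases h0 : (M.variation.rnDeriv μ x).toReal = 0
  · simp [M.relDensity_eq_zero h0]
  · rw [relDensity, norm_smul, Real.norm_of_nonneg ENNReal.toReal_nonneg]
    have h3 : (M.variation.rnDeriv μ x).toReal ≤ 1 := by
      simpa using ENNReal.toReal_mono ENNReal.one_ne_top h2
    exact (mul_le_of_le_one_left (norm_nonneg _) h3).trans ((h1 h0).trans (le_max_left _ _))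

theorem inner_toEuclideanCLM_left {A : Matrix (Fin n) (Fin n) ℂ} (hA : A.IsHermitian)
    (u v : EuclideanSpace ℂ (Fin n)) :
    ⟪Matrix.toEuclideanCLM (𝕜 := ℂ) A u, v⟫_ℂ = ⟪u, Matrix.toEuclideanCLM (𝕜 := ℂ) A v⟫_ℂ := by
  conv_rhs => rw [← hA.eq, ← Matrix.star_eq_conjTranspose, map_star,
    ContinuousLinearMap.star_eq_adjoint, ContinuousLinearMap.adjoint_inner_right]

theorem ae_inner_relDensity (M : MatrixDistribution α n) (h : M.variation ≤ μ)
    (hM : M.IsHermitian) : ∀ᵐ x ∂μ, ∀ u v,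
      ⟪M.relDensity μ x u, v⟫_ℂ = ⟪u, M.relDensity μ x v⟫_ℂ := by
  filter_upwards [M.ae_rnDeriv_imp h (M.ae_isHermitian_density hM)] with x h1 u v
  by_cases h0 : (M.variation.rnDeriv μ x).toReal = 0
  · simp [M.relDensity_eq_zero h0]
  · simp only [relDensity, _root_.smul_apply]
    rw [RCLike.real_smul_eq_coe_smul (K := ℂ), RCLike.real_smul_eq_coe_smul (K := ℂ), inner_smul_left,
      inner_smul_right, inner_toEuclideanCLM_left (h1 h0)]
    simp

theorem inner_relDensity (M : MatrixDistribution α n) (x : α) (u : EuclideanSpace ℂ (Fin n)) :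
    ⟪u, M.relDensity μ x u⟫_ℂ =
      (M.variation.rnDeriv μ x).toReal * (star u.ofLp ⬝ᵥ (M.density x *ᵥ u.ofLp)) := by
  rw [EuclideanSpace.inner_eq_star_dotProduct, ofLp_relDensity, dotProduct_comm, dotProduct_smul,
    Complex.real_smul]

theorem re_inner_relDensity_nonneg (M : MatrixDistribution α n) (hM : M.IsNonneg) (x : α)
    (u : EuclideanSpace ℂ (Fin n)) : 0 ≤ (⟪u, M.relDensity μ x u⟫_ℂ).re := by
  rw [inner_relDensity, Complex.re_ofReal_mul]
  exact mul_nonneg ENNReal.toReal_nonneg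
    (Complex.nonneg_iff.1 ((M.posSemidef_density hM x).dotProduct_mulVec_nonneg _)).1

/-- For a positive semidefinite matrix `A`, `u* A u = 0` forces `A u = 0`. This is the pointwise
source of the hypothesis `hW0` in the abstract argument. -/
theorem relDensity_apply_eq_zero (M : MatrixDistribution α n) (hM : M.IsNonneg) {x : α}
    {u : EuclideanSpace ℂ (Fin n)} (h : (⟪u, M.relDensity μ x u⟫_ℂ).re = 0) :
    M.relDensity μ x u = 0 := by
  by_cases h0 : (M.variation.rnDeriv μ x).toReal = 0
  · rw [M.relDensity_eq_zero h0, _root_.zero_apply]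
  have hA := M.posSemidef_density hM x
  rw [inner_relDensity, Complex.re_ofReal_mul, mul_eq_zero, or_iff_right h0] at h
  have h1 := (hA.dotProduct_mulVec_zero_iff u.ofLp).1 (Complex.ext h
    (Complex.nonneg_iff.1 (hA.dotProduct_mulVec_nonneg _)).2.symm)
  apply WithLp.ofLp_injective
  rw [ofLp_relDensity, h1, smul_zero]
  rfl

/-- The Radon-Nikodym change of measure; it lets the `q`- and `w`-terms of the equation be
integrated against one measure. -/
theorem integralOn_eq (M : MatrixDistribution α n) (h : M.variation ≤ μ) (u : α → Fin n → ℂ)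
    (s : Set α) (hs : MeasurableSet s) :
    M.integralOn u s = (∫ x in s, M.relDensity μ x (WithLp.toLp 2 (u x)) ∂μ).ofLp := by
  have : IsFiniteMeasure M.variation := isFiniteMeasure_of_le μ h
  have e := (PiLp.continuousLinearEquiv 2 ℂ fun _ : Fin n => ℂ).integral_comp_comm
    (μ := μ.restrict s) fun x => M.relDensity μ x (WithLp.toLp 2 (u x))
  refine Eq.trans ?_ e
  exact (setIntegral_rnDeriv_smul (Measure.absolutelyContinuous_of_le h) hs).symm

end

end MatrixDistribution

end BVSystem

/-! ### Balanced primitives of integrable functions -/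

namespace BVSystem
open MeasureTheory Set Topology Filter
open scoped ComplexOrder Matrix

section Primitive

variable {α : Type} [LinearOrder α] [DenselyOrdered α] [NoMinOrder α] [NoMaxOrder α]
  [TopologicalSpace α] [OrderTopology α] [SecondCountableTopology α] [CompactIccSpace α]
  [MeasurableSpace α] [BorelSpace α] {n : ℕ} {μ : Measure α}
  {E : Type*} [NormedAddCommGroup E] [NormedSpace ℝ E] [CompleteSpace E]

/-- Dominated convergence for indicator functions. It serves both the one-sided limits of primitives
and the smallness of `μ` near the endpoints. -/
theorem tendsto_setIntegral_of_eventually_mem_iff {g : α → E} (hg : Integrable g μ)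
    {l : Filter α} [l.IsCountablyGenerated] {A : α → Set α} {B : Set α}
    (hA : ∀ y, MeasurableSet (A y)) (hB : MeasurableSet B)
    (h : ∀ t, ∀ᶠ y in l, (t ∈ A y ↔ t ∈ B)) :
    Tendsto (fun y => ∫ t in A y, g t ∂μ) l (𝓝 (∫ t in B, g t ∂μ)) := by
  simp only [← integral_indicator, hA, hB]
  refine tendsto_integral_filter_of_dominated_convergence (fun t => ‖g t‖)
    (.of_forall fun y => (hg.indicator (hA y)).1)
    (.of_forall fun y => .of_forall fun t => norm_indicator_le_norm_self _ _) hg.norm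
    (.of_forall fun t => tendsto_const_nhds.congr' ?_)
  filter_upwards [h t] with y hy
  by_cases ht : t ∈ B
  · rw [indicator_of_mem ht, indicator_of_mem (hy.2 ht)]
  · rw [indicator_of_notMem ht, indicator_of_notMem fun h' => ht (hy.1 h')]

theorem eventually_nhdsLT_mem_Iio_iff (x t : α) : ∀ᶠ y in 𝓝[<] x, (t ∈ Iio y ↔ t ∈ Iio x) := by
  rcases lt_or_ge t x with h | h
  · filter_upwards [Ioo_mem_nhdsLT h] with y hy
    simp [h, hy.1]
  · filter_upwards [self_mem_nhdsWithin] with y hy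
    simp [h.not_gt, (lt_of_lt_of_le hy h).not_gt]

theorem eventually_nhdsLT_mem_Iic_iff (x t : α) : ∀ᶠ y in 𝓝[<] x, (t ∈ Iic y ↔ t ∈ Iio x) := by
  rcases lt_or_ge t x with h | h
  · filter_upwards [Ioo_mem_nhdsLT h] with y hy
    simp [h, hy.1.le]
  · filter_upwards [self_mem_nhdsWithin] with y hy
    simp [h.not_gt, lt_of_lt_of_le hy h]

theorem eventually_nhdsGT_mem_Iio_iff (x t : α) : ∀ᶠ y in 𝓝[>] x, (t ∈ Iio y ↔ t ∈ Iic x) := by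
  rcases lt_or_ge x t with h | h
  · filter_upwards [Ioo_mem_nhdsGT h] with y hy
    simp [h.not_ge, hy.2.not_gt]
  · filter_upwards [self_mem_nhdsWithin] with y hy
    simp [h, lt_of_le_of_lt h hy]

theorem eventually_nhdsGT_mem_Iic_iff (x t : α) : ∀ᶠ y in 𝓝[>] x, (t ∈ Iic y ↔ t ∈ Iic x) := by
  rcases lt_or_ge x t with h | h
  · filter_upwards [Ioo_mem_nhdsGT h] with y hy
    simp [h.not_ge, hy.2.not_ge]
  · filter_upwards [self_mem_nhdsWithin] with y hy
    simp [h, h.trans (le_of_lt hy)]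

theorem setIntegral_Iio_sub {g : α → E} (hg : Integrable g μ) {c d : α} (h : c ≤ d) :
    ∫ t in Iio d, g t ∂μ - ∫ t in Iio c, g t ∂μ = ∫ t in Ico c d, g t ∂μ := by
  rw [← Iio_union_Ico_eq_Iio h, setIntegral_union ?_ measurableSet_Ico hg.integrableOn
    hg.integrableOn, add_sub_cancel_left]
  exact (Iio_disjoint_Ici le_rfl).mono_right Ico_subset_Ici_self

theorem setIntegral_Iic_sub {g : α → E} (hg : Integrable g μ) {c d : α} (h : c ≤ d) :
    ∫ t in Iic d, g t ∂μ - ∫ t in Iic c, g t ∂μ = ∫ t in Ioc c d, g t ∂μ := by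
  rw [← Iic_union_Ioc_eq_Iic h, setIntegral_union ?_ measurableSet_Ioc hg.integrableOn
    hg.integrableOn, add_sub_cancel_left]
  exact (Iic_disjoint_Ioi le_rfl).mono_right Ioc_subset_Ioi_self

/-- A function whose increments are bounded by those of a monotone function is of locally bounded
variation. -/
theorem locallyBoundedVariationOn_of_norm_sub_le {f : α → E} {m : α → ℝ} (hm : Monotone m)
    (h : ∀ x y, x ≤ y → ‖f y - f x‖ ≤ m y - m x) : LocallyBoundedVariationOn f univ := by
  intro c d hc hd
  refine ne_top_of_le_ne_top ((hm.monotoneOn univ).locallyBoundedVariationOn c d hc hd)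
    (iSup_le fun p => ?_)
  refine le_trans (Finset.sum_le_sum fun i _ => ?_) (eVariationOn.sum_le p.2.2.1 p.2.2.2)
  have h1 := h _ _ (p.2.2.1 (Nat.le_succ i))
  rw [edist_dist, edist_dist, dist_eq_norm, Real.dist_eq]
  exact ENNReal.ofReal_le_ofReal (h1.trans (le_abs_self _))

/-- The mean of the left- and right-continuous primitives of `g`. -/
noncomputable def meanPrimitive (μ : Measure α) (g : α → E) (x : α) : E :=
  (2⁻¹ : ℝ) • (∫ t in Iio x, g t ∂μ + ∫ t in Iic x, g t ∂μ)

/-- As `y` increases to `x`, both `Iio y` and `Iic y` exhaust `Iio x`; as `y` decreases to `x`, both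
shrink to `Iic x`. So the one-sided limits are the two primitives at `x`, and the mean primitive is
balanced. -/
theorem tendsto_meanPrimitive_nhdsLT {g : α → E} (hg : Integrable g μ) (x : α) :
    Tendsto (meanPrimitive μ g) (𝓝[<] x) (𝓝 (∫ t in Iio x, g t ∂μ)) := by
  have h := ((tendsto_setIntegral_of_eventually_mem_iff hg (fun y => measurableSet_Iio)
    measurableSet_Iio (eventually_nhdsLT_mem_Iio_iff x)).add
    (tendsto_setIntegral_of_eventually_mem_iff hg (fun y => measurableSet_Iic)
    measurableSet_Iio (eventually_nhdsLT_mem_Iic_iff x))).const_smul (2⁻¹ : ℝ)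
  rwa [← two_smul ℝ, inv_smul_smul₀ two_ne_zero] at h

theorem tendsto_meanPrimitive_nhdsGT {g : α → E} (hg : Integrable g μ) (x : α) :
    Tendsto (meanPrimitive μ g) (𝓝[>] x) (𝓝 (∫ t in Iic x, g t ∂μ)) := by
  have h := ((tendsto_setIntegral_of_eventually_mem_iff hg (fun y => measurableSet_Iio)
    measurableSet_Iic (eventually_nhdsGT_mem_Iio_iff x)).add
    (tendsto_setIntegral_of_eventually_mem_iff hg (fun y => measurableSet_Iic)
    measurableSet_Iic (eventually_nhdsGT_mem_Iic_iff x))).const_smul (2⁻¹ : ℝ)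
  rwa [← two_smul ℝ, inv_smul_smul₀ two_ne_zero] at h

theorem meanPrimitive_sub {g : α → E} (hg : Integrable g μ) {x y : α} (h : x ≤ y) :
    meanPrimitive μ g y - meanPrimitive μ g x =
      (2⁻¹ : ℝ) • (∫ t in Ico x y, g t ∂μ + ∫ t in Ioc x y, g t ∂μ) := by
  rw [← setIntegral_Iio_sub hg h, ← setIntegral_Iic_sub hg h, meanPrimitive, meanPrimitive]
  module

theorem locallyBoundedVariationOn_meanPrimitive {g : α → E} (hg : Integrable g μ) :
    LocallyBoundedVariationOn (meanPrimitive μ g) univ := by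
  refine locallyBoundedVariationOn_of_norm_sub_le (m := meanPrimitive μ fun t => ‖g t‖) ?_ ?_
  · intro x y h
    rw [← sub_nonneg, meanPrimitive_sub hg.norm h, smul_eq_mul]
    have h1 : ∀ s, 0 ≤ ∫ t in s, ‖g t‖ ∂μ := fun s => integral_nonneg fun t => norm_nonneg (g t)
    exact mul_nonneg (by norm_num) (add_nonneg (h1 _) (h1 _))
  · intro x y h
    rw [meanPrimitive_sub hg.norm h, meanPrimitive_sub hg h, norm_smul, smul_eq_mul, Real.norm_of_nonneg (by norm_num)]
    gcongr
    exact (norm_add_le _ _).trans (add_le_add (norm_integral_le_integral_norm _)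
      (norm_integral_le_integral_norm _))

/-- As a function of `t`, `halfSign x t` is the mean of the indicators of `Iio x` and `Iic x`, minus
`1/2`. Its value `0` at `t = x` counts half of an atom at `x`, which is exactly what makes the
integral balanced in `x`. -/
theorem integral_halfSign_smul {E : Type*} [NormedAddCommGroup E] [NormedSpace ℂ E]
    [CompleteSpace E] {g : α → E} (hg : Integrable g μ) (x : α) :
    ∫ t, halfSign x t • g t ∂μ = meanPrimitive μ g x - (2⁻¹ : ℝ) • ∫ t, g t ∂μ := by
  have e : ∀ t, halfSign x t • g t =
      (2⁻¹ : ℝ) • ((Iio x).indicator g t + (Iic x).indicator g t) - (2⁻¹ : ℝ) • g t := by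
    intro t
    rcases lt_trichotomy t x with h | h | h
    · simp only [halfSign, h, if_true, mem_Iio, mem_Iic, h.le, indicator_of_mem]
      rw [show (2⁻¹ : ℂ) = ((2⁻¹ : ℝ) : ℂ) by simp, Complex.coe_smul]
      module
    · simp [halfSign, h]
    · simp only [halfSign, h, h.not_gt, if_true, if_false, mem_Iio, mem_Iic, h.not_ge,
        not_false_eq_true, indicator_of_notMem]
      rw [show (-2⁻¹ : ℂ) = ((-2⁻¹ : ℝ) : ℂ) by simp, Complex.coe_smul]
      module
  have i1 := hg.indicator (measurableSet_Iio (a := x))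
  have i2 := hg.indicator (measurableSet_Iic (a := x))
  simp only [e]
  have i3 := (i1.add i2).smul (2⁻¹ : ℝ)
  simp only [Pi.smul_def, Pi.add_apply] at i3
  have i4 : Integrable (fun t => (2⁻¹ : ℝ) • g t) μ := hg.smul (2⁻¹ : ℝ)
  rw [integral_sub i3 i4, integral_smul, integral_smul,
    integral_add i1 i2, integral_indicator measurableSet_Iio, integral_indicator measurableSet_Iic,
    meanPrimitive]

end Primitive

end BVSystem

/-! ### The equation as an integral identity for the measure `|q| + |w|` -/

namespace BVSystem
open MeasureTheory Set Topology Filter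
open scoped ComplexOrder Matrix

namespace System

open scoped InnerProductSpace ENNReal

variable {α : Type} [LinearOrder α] [DenselyOrdered α] [NoMinOrder α] [NoMaxOrder α]
  [TopologicalSpace α] [OrderTopology α] [SecondCountableTopology α] [CompactIccSpace α]
  [MeasurableSpace α] [BorelSpace α] {n : ℕ}

/-- The measure `|q| + |w|`. -/
noncomputable def measure (S : System α n) : Measure α := S.q.variation + S.w.variation

theorem variation_q_le (S : System α n) : S.q.variation ≤ S.measure :=
  Measure.le_add_right le_rfl

theorem variation_w_le (S : System α n) : S.w.variation ≤ S.measure :=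
  Measure.le_add_left le_rfl

theorem isHermitian_w (S : System α n) : S.w.IsHermitian := fun c d h => (S.nonneg_w c d h).1

theorem boundedVariationOn_univ {f : α → ℂ} (hf : LocallyBoundedVariationOn f univ) {c d : α}
    (hc : BoundedVariationOn f (Iio c)) (hd : BoundedVariationOn f (Ioi d)) :
    BoundedVariationOn f univ := by
  obtain ⟨c', hc'⟩ := exists_lt c
  -- With `c' < c` and `d' > d`, the closed rays that end at `c'` and `d'` lie inside the given open
  -- ones; the maximum ensures `c' ≤ d'`, and the middle piece is a compact interval.
  obtain ⟨d', hd'⟩ := exists_gt (max c' d)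
  have h1 : c' ≤ d' := (le_max_left c' d).trans hd'.le
  have e1 : (univ : Set α) = Iic d' ∪ Ici d' := Iic_union_Ici.symm
  have e2 : Iic d' = Iic c' ∪ Icc c' d' := (Iic_union_Icc_eq_Iic h1).symm
  rw [BoundedVariationOn, e1, eVariationOn.union f (x := d') isGreatest_Iic isLeast_Ici, e2,
    eVariationOn.union f (x := c') isGreatest_Iic (isLeast_Icc h1)]
  refine ENNReal.add_ne_top.2 ⟨ENNReal.add_ne_top.2 ⟨?_, ?_⟩, ?_⟩
  · exact hc.mono fun x hx => lt_of_le_of_lt hx hc'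
  · have := hf c' d' (mem_univ _) (mem_univ _)
    rwa [univ_inter] at this
  · exact hd.mono fun x hx => ((le_max_right c' d).trans_lt hd').trans_le hx

theorem isFiniteMeasure_measure {S : System α n} (ha : S.RegularLeft) (hb : S.RegularRight) :
    IsFiniteMeasure S.measure := by
  obtain ⟨c, hc⟩ := ha
  obtain ⟨d, hd⟩ := hb
  have := S.q.isFiniteMeasure_variation fun i j =>
    boundedVariationOn_univ (S.q.locBV i j) (hc i j).1 (hd i j).1
  have := S.w.isFiniteMeasure_variation fun i j =>
    boundedVariationOn_univ (S.w.locBV i j) (hc i j).2 (hd i j).2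
  unfold measure
  infer_instance

/-- The operator `-J⁻¹`. -/
noncomputable def negInvJ (S : System α n) :
    EuclideanSpace ℂ (Fin n) →L[ℂ] EuclideanSpace ℂ (Fin n) :=
  Matrix.toEuclideanCLM (𝕜 := ℂ) (-S.J⁻¹)

theorem J_mulVec_negInvJ (S : System α n) (v : EuclideanSpace ℂ (Fin n)) :
    S.J *ᵥ (S.negInvJ v).ofLp = -v.ofLp := by
  rw [negInvJ, Matrix.ofLp_toEuclideanCLM, Matrix.mulVec_mulVec, mul_neg,
    Matrix.mul_nonsing_inv _ ((Matrix.isUnit_iff_isUnit_det _).1 S.isUnit_J), Matrix.neg_mulVec,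
    Matrix.one_mulVec]

theorem J_mulVec_injective (S : System α n) : Function.Injective (S.J *ᵥ ·) :=
  Matrix.mulVec_injective_of_isUnit S.isUnit_J

theorem inner_negInvJ (S : System α n) (u v : EuclideanSpace ℂ (Fin n)) :
    ⟪S.negInvJ u, v⟫_ℂ = -⟪u, S.negInvJ v⟫_ℂ := by
  have h : (-S.J⁻¹)ᴴ = -(-S.J⁻¹) := by
    rw [Matrix.conjTranspose_neg, Matrix.conjTranspose_nonsing_inv, S.skew_J, neg_neg]
    have := Matrix.mul_nonsing_inv _ ((Matrix.isUnit_iff_isUnit_det _).1 S.isUnit_J)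
    rw [neg_eq_iff_eq_neg]
    exact Matrix.inv_eq_right_inv (by rw [neg_mul_neg, this])
  have e : ContinuousLinearMap.adjoint S.negInvJ = -S.negInvJ := by
    rw [← ContinuousLinearMap.star_eq_adjoint, negInvJ, ← map_star, Matrix.star_eq_conjTranspose,
      h, map_neg]
  rw [← ContinuousLinearMap.adjoint_inner_right, e, _root_.neg_apply, inner_neg_right]

/-- The density of `q - z w`. -/
noncomputable def coeff (S : System α n) (z : ℂ) (x : α) :
    EuclideanSpace ℂ (Fin n) →L[ℂ] EuclideanSpace ℂ (Fin n) :=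
  S.q.relDensity S.measure x - z • S.w.relDensity S.measure x

/-- The right-hand side of the equation `u' = -J⁻¹ (q - z w) u`. -/
noncomputable def rhs (S : System α n) (z : ℂ) (U : α → EuclideanSpace ℂ (Fin n)) (x : α) :
    EuclideanSpace ℂ (Fin n) := S.negInvJ (S.coeff z x (U x))

variable {S : System α n} [IsFiniteMeasure S.measure]

theorem integrableOn_apply {B : α → EuclideanSpace ℂ (Fin n) →L[ℂ] EuclideanSpace ℂ (Fin n)}
    {μ : Measure α} {C : ℝ} (hB : StronglyMeasurable B) (hC : ∀ᵐ x ∂μ, ‖B x‖ ≤ C)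
    {U : α → EuclideanSpace ℂ (Fin n)} {s : Set α} (hU : IntegrableOn U s μ) :
    IntegrableOn (fun x => B x (U x)) s μ := by
  refine (hU.norm.const_mul C).mono' ?_ ?_
  · exact isBoundedBilinearMap_apply.continuous.comp_aestronglyMeasurable₂
      hB.aestronglyMeasurable hU.1
  · filter_upwards [ae_restrict_of_ae hC] with x hx
    exact ((B x).le_opNorm _).trans (by gcongr)

theorem integrableOn_q {U : α → EuclideanSpace ℂ (Fin n)} {s : Set α}
    (hU : IntegrableOn U s S.measure) :
    IntegrableOn (fun x => S.q.relDensity S.measure x (U x)) s S.measure := by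
  obtain ⟨C, hC⟩ := S.q.exists_ae_norm_relDensity_le S.variation_q_le
  exact integrableOn_apply (S.q.stronglyMeasurable_relDensity _) hC hU

theorem integrableOn_w {U : α → EuclideanSpace ℂ (Fin n)} {s : Set α}
    (hU : IntegrableOn U s S.measure) :
    IntegrableOn (fun x => S.w.relDensity S.measure x (U x)) s S.measure := by
  obtain ⟨C, hC⟩ := S.w.exists_ae_norm_relDensity_le S.variation_w_le
  exact integrableOn_apply (S.w.stronglyMeasurable_relDensity _) hC hU

theorem integrableOn_rhs {z : ℂ} {U : α → EuclideanSpace ℂ (Fin n)} {s : Set α}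
    (hU : IntegrableOn U s S.measure) : IntegrableOn (S.rhs z U) s S.measure :=
  S.negInvJ.integrable_comp ((integrableOn_q hU).sub ((integrableOn_w hU).smul z))

/-- The densities of `q` and `w` are essentially bounded. The exceptional null set and `C` depend on
the coefficients and on `z` only, not on `U`. -/
theorem exists_ae_norm_rhs_le (S : System α n) [IsFiniteMeasure S.measure] (z : ℂ) :
    ∃ C : ℝ, 0 ≤ C ∧ ∀ᵐ x ∂S.measure, ∀ U : α → EuclideanSpace ℂ (Fin n),
      ‖S.rhs z U x‖ ≤ C * ‖U x‖ := by
  obtain ⟨C, hC⟩ := S.q.exists_ae_norm_relDensity_le S.variation_q_le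
  obtain ⟨D, hD⟩ := S.w.exists_ae_norm_relDensity_le S.variation_w_le
  refine ⟨‖S.negInvJ‖ * (max C 0 + ‖z‖ * max D 0), by positivity, ?_⟩
  filter_upwards [hC, hD] with x h1 h2 U
  refine (S.negInvJ.le_opNorm _).trans ?_
  rw [mul_assoc]
  gcongr
  refine ((S.coeff z x).le_opNorm _).trans ?_
  gcongr
  refine (norm_sub_le _ _).trans ?_
  rw [norm_smul]
  gcongr
  · exact h1.trans (le_max_left _ _)
  · exact h2.trans (le_max_left _ _)

theorem setIntegral_rhs {z : ℂ} {u : α → Fin n → ℂ} {s : Set α} (hs : MeasurableSet s)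
    (hU : IntegrableOn (fun x => WithLp.toLp 2 (u x)) s S.measure) :
    S.J *ᵥ (∫ x in s, S.rhs z (fun x => WithLp.toLp 2 (u x)) x ∂S.measure).ofLp =
      S.w.integralOn (z • u) s - S.q.integralOn u s := by
  have e1 : ∫ x in s, S.rhs z (fun x => WithLp.toLp 2 (u x)) x ∂S.measure = S.negInvJ
      (∫ x in s, S.q.relDensity S.measure x (WithLp.toLp 2 (u x)) ∂S.measure -
        ∫ x in s, S.w.relDensity S.measure x (WithLp.toLp 2 ((z • u) x)) ∂S.measure) := by
    have i1 := integrableOn_q hU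
    have i2 : IntegrableOn (fun x => S.w.relDensity S.measure x (WithLp.toLp 2 ((z • u) x))) s
        S.measure := by
      simp only [Pi.smul_apply, WithLp.toLp_smul, map_smul]
      exact (integrableOn_w hU).smul z
    rw [← integral_sub i1 i2]
    refine Eq.trans ?_ (S.negInvJ.integral_comp_comm (i1.sub i2))
    simp only [rhs, coeff, _root_.sub_apply, _root_.smul_apply, Pi.smul_apply, WithLp.toLp_smul,
      map_smul]
  rw [e1, J_mulVec_negInvJ, S.q.integralOn_eq S.variation_q_le _ _ hs,
    S.w.integralOn_eq S.variation_w_le _ _ hs, WithLp.ofLp_sub, neg_sub]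

/-- Multiplication by the invertible `J` passes between the two forms of the equation. -/
theorem solves_iff {z : ℂ} {u : α → Fin n → ℂ}
    (hU : ∀ c d, IntegrableOn (fun x => WithLp.toLp 2 (u x)) (Ico c d) S.measure) :
    S.Solves u (z • u) ↔ ∀ c d, c ≤ d → Function.leftLim u d - Function.leftLim u c =
      (∫ x in Ico c d, S.rhs z (fun x => WithLp.toLp 2 (u x)) x ∂S.measure).ofLp := by
  refine forall_congr' fun c => forall_congr' fun d => imp_congr_right fun h => ?_
  refine Iff.trans ?_ S.J_mulVec_injective.eq_iff
  dsimp only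
  rw [setIntegral_rhs measurableSet_Ico (hU c d), eq_sub_iff_add_eq]

end System

end BVSystem

/-! ### Balanced solutions are the solutions of the integral equation -/

namespace BVSystem
open MeasureTheory Set Topology Filter
open scoped ComplexOrder Matrix

namespace System

open scoped InnerProductSpace ENNReal

variable {α : Type} [LinearOrder α] [DenselyOrdered α] [NoMinOrder α] [NoMaxOrder α]
  [TopologicalSpace α] [OrderTopology α] [SecondCountableTopology α] [CompactIccSpace α]
  [MeasurableSpace α] [BorelSpace α] {n : ℕ} {S : System α n} [IsFiniteMeasure S.measure]

/-- The integral equation `U = c - J⁻¹ ∫ sign (· - t) / 2 (q - z w) U` for square integrable `U`. -/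
structure IsIntegralSolution (S : System α n) (z : ℂ) (c : EuclideanSpace ℂ (Fin n))
    (U : α → EuclideanSpace ℂ (Fin n)) : Prop where
  memLp : MemLp U 2 S.measure
  eq : ∀ x, U x = c + ∫ t, halfSign x t • S.rhs z U t ∂S.measure

theorem integrable_rhs {z : ℂ} {U : α → EuclideanSpace ℂ (Fin n)} (hU : Integrable U S.measure) :
    Integrable (S.rhs z U) S.measure := by
  rw [← integrableOn_univ] at hU ⊢
  exact integrableOn_rhs hU

theorem IsIntegralSolution.integrable {z : ℂ} {c : EuclideanSpace ℂ (Fin n)}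
    {U : α → EuclideanSpace ℂ (Fin n)} (h : S.IsIntegralSolution z c U) :
    Integrable U S.measure := h.memLp.integrable (by norm_num)

theorem IsIntegralSolution.eq_meanPrimitive {z : ℂ} {c : EuclideanSpace ℂ (Fin n)}
    {U : α → EuclideanSpace ℂ (Fin n)} (h : S.IsIntegralSolution z c U) (x : α) :
    U x = (c - (2⁻¹ : ℝ) • ∫ t, S.rhs z U t ∂S.measure) +
      meanPrimitive S.measure (S.rhs z U) x := by
  rw [h.eq x, integral_halfSign_smul (integrable_rhs h.integrable)]
  abel

section

variable {z : ℂ} {c : EuclideanSpace ℂ (Fin n)} {u : α → Fin n → ℂ}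

theorem IsIntegralSolution.leftLim_rightLim
    (h : S.IsIntegralSolution z c fun x => WithLp.toLp 2 (u x)) (x : α) :
    Function.leftLim u x = ((c - (2⁻¹ : ℝ) • ∫ t, S.rhs z (fun x => WithLp.toLp 2 (u x)) t
        ∂S.measure) + ∫ t in Iio x, S.rhs z (fun x => WithLp.toLp 2 (u x)) t ∂S.measure).ofLp ∧
    Function.rightLim u x = ((c - (2⁻¹ : ℝ) • ∫ t, S.rhs z (fun x => WithLp.toLp 2 (u x)) t
        ∂S.measure) + ∫ t in Iic x, S.rhs z (fun x => WithLp.toLp 2 (u x)) t ∂S.measure).ofLp := by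
  have e : u = fun x => ((c - (2⁻¹ : ℝ) • ∫ t, S.rhs z (fun x => WithLp.toLp 2 (u x)) t
      ∂S.measure) + meanPrimitive S.measure (S.rhs z fun x => WithLp.toLp 2 (u x)) x).ofLp :=
    funext fun x => congrArg WithLp.ofLp (h.eq_meanPrimitive x)
  have hi := integrable_rhs (z := z) h.integrable
  have hc : Continuous (WithLp.ofLp : EuclideanSpace ℂ (Fin n) → Fin n → ℂ) :=
    PiLp.continuous_ofLp 2 _
  constructor
  · refine leftLim_eq_of_tendsto ?_
    conv => enter [1]; rw [e]
    exact (hc.tendsto _).comp (tendsto_const_nhds.add (tendsto_meanPrimitive_nhdsLT hi x))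
  · refine rightLim_eq_of_tendsto ?_
    conv => enter [1]; rw [e]
    exact (hc.tendsto _).comp (tendsto_const_nhds.add (tendsto_meanPrimitive_nhdsGT hi x))

theorem IsIntegralSolution.isBalancedBV
    (h : S.IsIntegralSolution z c fun x => WithLp.toLp 2 (u x)) : IsBalancedBV u := by
  have hi := integrable_rhs (z := z) h.integrable
  refine ⟨?_, fun x => ?_⟩
  · have e : u = (fun v : EuclideanSpace ℂ (Fin n) =>
        ((c - (2⁻¹ : ℝ) • ∫ t, S.rhs z (fun x => WithLp.toLp 2 (u x)) t ∂S.measure) + v).ofLp) ∘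
          meanPrimitive S.measure (S.rhs z fun x => WithLp.toLp 2 (u x)) :=
      funext fun x => congrArg WithLp.ofLp (h.eq_meanPrimitive x)
    rw [e]
    -- The identity from the Euclidean norm to the sup norm does not increase distances, so bounded
    -- variation carries over.
    refine LipschitzWith.comp_locallyBoundedVariationOn (C := 1) ?_
      (locallyBoundedVariationOn_meanPrimitive hi)
    intro v w
    refine (PiLp.lipschitzWith_ofLp 2 (fun _ : Fin n => ℂ) _ _).trans ?_
    rw [edist_add_left]
  · obtain ⟨h1, h2⟩ := h.leftLim_rightLim x
    rw [h1, h2, ← WithLp.ofLp_add, ← WithLp.ofLp_smul]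
    refine congrArg WithLp.ofLp ((h.eq_meanPrimitive x).trans ?_)
    rw [meanPrimitive, show (2⁻¹ : ℂ) = ((2⁻¹ : ℝ) : ℂ) by simp, Complex.coe_smul]
    module

theorem IsIntegralSolution.solves
    (h : S.IsIntegralSolution z c fun x => WithLp.toLp 2 (u x)) : S.Solves u (z • u) := by
  refine (solves_iff fun c d => h.integrable.integrableOn).2 fun a b hab => ?_
  rw [(h.leftLim_rightLim a).1, (h.leftLim_rightLim b).1, ← WithLp.ofLp_sub, add_sub_add_left_eq_sub,
    setIntegral_Iio_sub (integrable_rhs h.integrable) hab]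

theorem wForm_eq_inner (S : System α n) (u : α → Fin n → ℂ) (x : α) :
    S.wForm u u x =
      ⟪WithLp.toLp 2 (u x), Matrix.toEuclideanCLM (𝕜 := ℂ) (S.w.density x) (WithLp.toLp 2 (u x))⟫_ℂ := by
  rw [EuclideanSpace.inner_eq_star_dotProduct, dotProduct_comm]
  rfl

theorem memL2_of_memLp (h : MemLp (fun x => WithLp.toLp 2 (u x)) 2 S.measure) : S.MemL2 u := by
  have h' := h.mono_measure S.variation_w_le
  have hm : AEMeasurable u S.w.variation :=
    (PiLp.continuous_ofLp 2 _).measurable.comp_aemeasurable h'.1.aemeasurable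
  refine ⟨hm, ?_⟩
  obtain ⟨C, hC⟩ := S.w.exists_ae_norm_toEuclideanCLM_density_le
  refine (h'.integrable_norm_pow two_ne_zero |>.const_mul C).mono'
    (S.aemeasurable_wForm hm hm).aestronglyMeasurable ?_
  filter_upwards [hC] with x hx
  rw [wForm_eq_inner]
  refine (norm_inner_le_norm _ _).trans ?_
  calc _ ≤ ‖WithLp.toLp 2 (u x)‖ * (C * ‖WithLp.toLp 2 (u x)‖) := by
        gcongr
        exact (ContinuousLinearMap.le_opNorm _ _).trans (by gcongr)
    _ = _ := by ring

/-- For solutions, norm zero in `L²(w)` is the vanishing of the density of `w u`. -/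
theorem inner_self_eq_zero_iff_relDensity (h : MemLp (fun x => WithLp.toLp 2 (u x)) 2 S.measure) :
    S.inner u u = 0 ↔
      ∀ᵐ x ∂S.measure, S.w.relDensity S.measure x (WithLp.toLp 2 (u x)) = 0 := by
  rw [S.inner_self_eq_zero_iff (memL2_of_memLp h)]
  have hac := Measure.absolutelyContinuous_of_le S.variation_w_le
  have : IsFiniteMeasure S.w.variation := isFiniteMeasure_of_le _ S.variation_w_le
  constructor
  · intro h0
    filter_upwards [S.w.ae_rnDeriv_imp S.variation_w_le h0] with x hx
    refine S.w.relDensity_apply_eq_zero S.nonneg_w ?_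
    by_cases h1 : (S.w.variation.rnDeriv S.measure x).toReal = 0
    · simp [S.w.relDensity_eq_zero h1]
    · rw [MatrixDistribution.inner_relDensity]
      change (_ * S.wForm u u x).re = 0
      simp [hx h1]
  · intro h0
    -- Almost everywhere for `|w|` the factor `d|w|/dμ` is positive and finite and can be cancelled.
    filter_upwards [hac.ae_le h0, Measure.rnDeriv_pos hac,
      hac.ae_le (Measure.rnDeriv_lt_top S.w.variation S.measure)] with x h1 h2 h3
    have h4 := congrArg WithLp.ofLp h1
    rw [MatrixDistribution.ofLp_relDensity, WithLp.ofLp_zero,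
      smul_eq_zero_iff_right (ENNReal.toReal_pos h2.ne' h3.ne).ne'] at h4
    change star (u x) ⬝ᵥ (S.w.density x *ᵥ u x) = 0
    rw [h4, dotProduct_zero]

theorem measurable_toLp (hu : IsBalancedBV u) : Measurable fun x => WithLp.toLp 2 (u x) :=
  (PiLp.continuous_toLp 2 _).measurable.comp (measurable_pi_lambda _ (locBV_measurable hu.1))

theorem exists_norm_toLp_le (hu : IsBalancedBV u) (a b : α) :
    ∃ K : ℝ, ∀ x ∈ Icc a b, ‖WithLp.toLp 2 (u x)‖ ≤ K := by
  obtain ⟨K, hK⟩ := locBV_bounded hu.1 a b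
  obtain ⟨L, hL⟩ := (isCompact_closedBall (0 : Fin n → ℂ) K).exists_bound_of_continuousOn
    (PiLp.continuous_toLp 2 fun _ : Fin n => ℂ).continuousOn
  exact ⟨L, fun x hx => hL _ (by simpa using hK x hx)⟩

theorem integrableOn_toLp (hu : IsBalancedBV u) (a b : α) :
    IntegrableOn (fun x => WithLp.toLp 2 (u x)) (Icc a b) S.measure := by
  obtain ⟨K, hK⟩ := exists_norm_toLp_le hu a b
  exact Integrable.of_bound (measurable_toLp hu).aestronglyMeasurable K
    ((ae_restrict_mem measurableSet_Icc).mono hK)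

theorem exists_measureReal_Ioi_lt [Nonempty α] {ε : ℝ} (hε : 0 < ε) :
    ∃ b, S.measure.real (Ioi b) < ε := by
  have h := tendsto_setIntegral_of_eventually_mem_iff (μ := S.measure) (l := atTop)
    (A := Ioi) (B := ∅) (integrable_const (1 : ℝ)) (fun _ => measurableSet_Ioi) MeasurableSet.empty
    (fun t => (eventually_ge_atTop t).mono fun y hy => by simp [hy])
  simp only [setIntegral_const, smul_eq_mul, mul_one, measureReal_empty] at h
  exact (h.eventually (gt_mem_nhds hε)).exists

theorem exists_measureReal_Iio_lt [Nonempty α] {ε : ℝ} (hε : 0 < ε) :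
    ∃ a, S.measure.real (Iio a) < ε := by
  have h := tendsto_setIntegral_of_eventually_mem_iff (μ := S.measure) (l := atBot)
    (A := Iio) (B := ∅) (integrable_const (1 : ℝ)) (fun _ => measurableSet_Iio) MeasurableSet.empty
    (fun t => (eventually_le_atBot t).mono fun y hy => by simp [hy])
  simp only [setIntegral_const, smul_eq_mul, mul_one, measureReal_empty] at h
  exact (h.eventually (gt_mem_nhds hε)).exists

/-- The right limit of `u` at `x` is also the right limit of the function `leftLim u`, so it stays
in the closed ball; `u x` is the mean of the two limits. -/
theorem norm_toLp_le_of_leftLim {K : ℝ} (hu : IsBalancedBV u) {s : Set α} (hs : IsOpen s)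
    (h : ∀ x ∈ s, ‖WithLp.toLp 2 (Function.leftLim u x)‖ ≤ K) {x : α} (hx : x ∈ s) :
    ‖WithLp.toLp 2 (u x)‖ ≤ K := by
  have hcl : IsClosed {v : Fin n → ℂ | ‖WithLp.toLp 2 v‖ ≤ K} :=
    isClosed_le (PiLp.continuous_toLp 2 _).norm continuous_const
  have h2 : ‖WithLp.toLp 2 (Function.rightLim u x)‖ ≤ K := by
    rw [← rightLim_leftLim (locBV_tendsto hu.1 x).2]
    exact hcl.mem_of_mapClusterPt (mapClusterPt_rightLim _ _)
      (mem_nhdsWithin_of_mem_nhds <| mem_of_superset (hs.mem_nhds hx) fun y hy => h y hy)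
  rw [hu.2 x, WithLp.toLp_smul, WithLp.toLp_add, norm_smul]
  have h3 := norm_add_le (WithLp.toLp 2 (Function.leftLim u x))
    (WithLp.toLp 2 (Function.rightLim u x))
  have h4 : ‖(2⁻¹ : ℂ)‖ = 2⁻¹ := by simp
  rw [h4]
  linarith [h x hx]

/-- The part of `s` inside `[a, b]` contributes at most the fixed number `∫ ‖U‖` over `[a, b]`; only
the part near the endpoints is estimated by the supremum `M`, and there the measure is small. -/
theorem norm_setIntegral_rhs_le {C M : ℝ} (hC0 : 0 ≤ C)
    (hC : ∀ᵐ x ∂S.measure, ∀ U : α → EuclideanSpace ℂ (Fin n), ‖S.rhs z U x‖ ≤ C * ‖U x‖)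
    {U : α → EuclideanSpace ℂ (Fin n)} {a b : α} {s : Set α} (hs : MeasurableSet s)
    (hab : IntegrableOn U (Icc a b) S.measure) (hUs : IntegrableOn U s S.measure)
    (hM0 : 0 ≤ M) (hM : ∀ x ∈ s, ‖U x‖ ≤ M) :
    ‖∫ x in s, S.rhs z U x ∂S.measure‖ ≤ C * (∫ x in Icc a b, ‖U x‖ ∂S.measure +
      M * (S.measure.real (Iio a) + S.measure.real (Ioi b))) := by
  calc ‖∫ x in s, S.rhs z U x ∂S.measure‖ ≤ ∫ x in s, C * ‖U x‖ ∂S.measure :=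
        norm_integral_le_of_norm_le (hUs.norm.const_mul C)
          (ae_restrict_of_ae (hC.mono fun x hx => hx U))
    _ = C * ∫ x in s, ‖U x‖ ∂S.measure := integral_const_mul _ _
    _ ≤ _ := by
      have h1 : ∫ x in s ∩ Icc a b, ‖U x‖ ∂S.measure ≤ ∫ x in Icc a b, ‖U x‖ ∂S.measure :=
        setIntegral_mono_set hab.norm (.of_forall fun x => norm_nonneg _)
          (ae_of_all _ inter_subset_right)
      have h2 : ∫ x in s \ Icc a b, ‖U x‖ ∂S.measure ≤
          M * (S.measure.real (Iio a) + S.measure.real (Ioi b)) := by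
        calc ∫ x in s \ Icc a b, ‖U x‖ ∂S.measure ≤ ∫ x in s \ Icc a b, M ∂S.measure :=
              setIntegral_mono_on (hUs.mono_set sdiff_subset).norm
                (integrable_const M).integrableOn (hs.diff measurableSet_Icc) fun x hx => hM x hx.1
          _ = M * S.measure.real (s \ Icc a b) := by
              rw [setIntegral_const, smul_eq_mul, mul_comm]
          _ ≤ M * S.measure.real (Iio a ∪ Ioi b) := by
              refine mul_le_mul_of_nonneg_left (measureReal_mono ?_) hM0
              rintro x ⟨-, hx⟩
              rw [mem_Icc, not_and_or, not_le, not_le] at hx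
              exact hx
          _ ≤ _ := mul_le_mul_of_nonneg_left (measureReal_union_le _ _) hM0
      rw [← integral_inter_add_sdiff (measurableSet_Icc (a := a) (b := b)) hUs.norm]
      gcongr

/-- An absorption argument in place of Gronwall's inequality. Let `M` be the supremum of `‖U‖` over
a bounded interval around `c`, finite because `u` has locally bounded variation. Integrating from
`c` gives `M ≤ K + M / 2`, so `M ≤ 2 K`, where `K` does not depend on that interval. -/
theorem exists_norm_le_of_solves (hu : IsBalancedBV u) (h : S.Solves u (z • u)) :
    ∃ K : ℝ, ∀ x, ‖WithLp.toLp 2 (u x)‖ ≤ K := by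
  rcases isEmpty_or_nonempty α with hα | ⟨⟨c⟩⟩
  · exact ⟨0, fun x => hα.elim x⟩
  have : Nonempty α := ⟨c⟩
  set U : α → EuclideanSpace ℂ (Fin n) := fun x => WithLp.toLp 2 (u x) with hU
  have hint : ∀ p r, IntegrableOn U (Icc p r) S.measure := integrableOn_toLp hu
  rw [solves_iff fun p r => (hint p r).mono_set Ico_subset_Icc_self] at h
  obtain ⟨C, hC0, hC⟩ := S.exists_ae_norm_rhs_le z
  -- The two tails together then have measure at most `1 / (2 (C + 1))`, which gives the factor `1 /
  -- 2` in `hsmall`.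
  obtain ⟨b, hb⟩ := exists_measureReal_Ioi_lt (S := S) (ε := 1 / (4 * (C + 1))) (by positivity)
  obtain ⟨a, ha⟩ := exists_measureReal_Iio_lt (S := S) (ε := 1 / (4 * (C + 1))) (by positivity)
  set K := ‖WithLp.toLp 2 (Function.leftLim u c)‖ + C * ∫ x in Icc a b, ‖U x‖ ∂S.measure with hK
  have hsmall : C * (S.measure.real (Iio a) + S.measure.real (Ioi b)) ≤ 1 / 2 := by
    calc _ ≤ C * (1 / (4 * (C + 1)) + 1 / (4 * (C + 1))) := by gcongr
      _ = C / (C + 1) / 2 := by field_simp; ring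
      _ ≤ 1 / 2 := by
        gcongr
        rw [div_le_one (by positivity)]
        linarith
  have step : ∀ p r, p < c → c < r → ∀ M, 0 ≤ M → (∀ x ∈ Ioo p r, ‖U x‖ ≤ M) →
      ∀ x ∈ Ioo p r, ‖U x‖ ≤ K + M / 2 := by
    intro p r hp hr M hM0 hM x hx
    refine norm_toLp_le_of_leftLim hu isOpen_Ioo (fun y hy => ?_) hx
    have bound : ∀ s ⊆ Ioo p r, MeasurableSet s → ‖∫ x in s, S.rhs z U x ∂S.measure‖ ≤
        C * (∫ x in Icc a b, ‖U x‖ ∂S.measure) + M / 2 := by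
      intro s hs hsm
      refine (norm_setIntegral_rhs_le hC0 hC hsm (hint a b)
        ((hint p r).mono_set (hs.trans Ioo_subset_Icc_self)) hM0 fun x hx => hM x (hs hx)).trans ?_
      have := mul_le_mul_of_nonneg_left hsmall hM0
      linarith
    rcases le_total c y with hcy | hcy
    · have e := congrArg (WithLp.toLp 2) (h c y hcy)
      rw [WithLp.toLp_ofLp, WithLp.toLp_sub, sub_eq_iff_eq_add'] at e
      rw [e, hK, add_assoc]
      refine (norm_add_le _ _).trans ?_
      gcongr
      exact bound _ (fun t ht => ⟨hp.trans_le ht.1, ht.2.trans hy.2⟩) measurableSet_Ico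
    · have e := congrArg (WithLp.toLp 2) (h y c hcy)
      rw [WithLp.toLp_ofLp, WithLp.toLp_sub, sub_eq_iff_eq_add, ← sub_eq_iff_eq_add'] at e
      rw [← e, hK, add_assoc]
      refine (norm_sub_le _ _).trans ?_
      gcongr
      exact bound _ (fun t ht => ⟨hy.1.trans_le ht.1, ht.2.trans hr⟩) measurableSet_Ico
  refine ⟨2 * K, fun x => ?_⟩
  obtain ⟨p, hp⟩ := exists_lt (min x c)
  obtain ⟨r, hr⟩ := exists_gt (max x c)
  have hx : x ∈ Ioo p r := ⟨hp.trans_le (min_le_left _ _), (le_max_left _ _).trans_lt hr⟩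
  have hpc := hp.trans_le (min_le_right _ _)
  have hcr := (le_max_right _ _).trans_lt hr
  obtain ⟨L, hL⟩ := exists_norm_toLp_le hu p r
  have hbdd : BddAbove ((fun x => ‖U x‖) '' Ioo p r) := ⟨L, by
    rintro _ ⟨y, hy, rfl⟩
    exact hL y (Ioo_subset_Icc_self hy)⟩
  have hne : ((fun x => ‖U x‖) '' Ioo p r).Nonempty := ⟨_, x, hx, rfl⟩
  set M := sSup ((fun x => ‖U x‖) '' Ioo p r)
  have hM : ∀ y ∈ Ioo p r, ‖U y‖ ≤ M := fun y hy => le_csSup hbdd ⟨y, hy, rfl⟩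
  have hM0 : 0 ≤ M := (norm_nonneg _).trans (hM x hx)
  have hMle : M ≤ K + M / 2 := csSup_le hne (by
    rintro _ ⟨y, hy, rfl⟩
    exact step p r hpc hcr M hM0 hM y hy)
  linarith [hM x hx]

/-- Boundedness makes the right-hand side integrable up to both endpoints. Hence `leftLim u` and
`rightLim u` are `ξ` plus the integrals over `Iio x` and `Iic x`, where `ξ` is the limit of `u` at
the left endpoint, and balance recovers `u` as their mean. -/
theorem exists_isIntegralSolution (hu : IsBalancedBV u) (h : S.Solves u (z • u)) :
    ∃ c, S.IsIntegralSolution z c fun x => WithLp.toLp 2 (u x) := by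
  obtain ⟨K, hK⟩ := exists_norm_le_of_solves hu h
  have hmem : MemLp (fun x => WithLp.toLp 2 (u x)) 2 S.measure :=
    MemLp.of_bound (measurable_toLp hu).aestronglyMeasurable K (.of_forall hK)
  rcases isEmpty_or_nonempty α with hα | ⟨⟨c⟩⟩
  · exact ⟨0, hmem, fun x => hα.elim x⟩
  have hi : Integrable (fun x => WithLp.toLp 2 (u x)) S.measure := hmem.integrable (by norm_num)
  rw [solves_iff fun p r => hi.integrableOn] at h
  set g := S.rhs z fun x => WithLp.toLp 2 (u x) with hg
  have hgi : Integrable g S.measure := integrable_rhs hi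
  set ξ := WithLp.toLp 2 (Function.leftLim u c) - ∫ t in Iio c, g t ∂S.measure with hξ
  have hleft : ∀ x, Function.leftLim u x = (ξ + ∫ t in Iio x, g t ∂S.measure).ofLp := by
    intro x
    apply WithLp.toLp_injective 2
    change WithLp.toLp 2 (Function.leftLim u x) = ξ + ∫ t in Iio x, g t ∂S.measure
    rw [hξ]
    rcases le_total c x with hcx | hcx
    · have e : WithLp.toLp 2 (Function.leftLim u x) - WithLp.toLp 2 (Function.leftLim u c) =
        ∫ x in Ico c x, g x ∂S.measure := congrArg (WithLp.toLp 2) (h c x hcx)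
      rw [← setIntegral_Iio_sub hgi hcx, sub_eq_iff_eq_add] at e
      rw [e]
      abel
    · have e : WithLp.toLp 2 (Function.leftLim u c) - WithLp.toLp 2 (Function.leftLim u x) =
        ∫ x in Ico x c, g x ∂S.measure := congrArg (WithLp.toLp 2) (h x c hcx)
      rw [← setIntegral_Iio_sub hgi hcx, sub_eq_iff_eq_add] at e
      rw [e]
      abel
  have hright : ∀ x, Function.rightLim u x = (ξ + ∫ t in Iic x, g t ∂S.measure).ofLp := by
    intro x
    rw [← rightLim_leftLim (locBV_tendsto hu.1 x).2]
    refine rightLim_eq_of_tendsto ?_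
    rw [show Function.leftLim u = _ from funext hleft]
    exact ((PiLp.continuous_ofLp 2 _).tendsto _).comp (tendsto_const_nhds.add
      (tendsto_setIntegral_of_eventually_mem_iff hgi (fun y => measurableSet_Iio)
        measurableSet_Iic (eventually_nhdsGT_mem_Iio_iff x)))
  -- The constant is the mean of the limits of `u` at the two endpoints.
  refine ⟨ξ + (2⁻¹ : ℝ) • ∫ t, g t ∂S.measure, hmem, fun x => ?_⟩
  rw [integral_halfSign_smul hgi, add_add_sub_cancel, meanPrimitive, hu.2 x, hleft, hright,
    WithLp.toLp_smul, WithLp.toLp_add, WithLp.toLp_ofLp, WithLp.toLp_ofLp,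
    show (2⁻¹ : ℂ) = ((2⁻¹ : ℝ) : ℂ) by simp, Complex.coe_smul]
  module

end

end System

end BVSystem

/-! ### The operator form of the equation and conjugation of the parameter -/

namespace BVSystem
open MeasureTheory Set Topology Filter
open scoped ComplexOrder Matrix

section Multiplication

open scoped InnerProductSpace ENNReal

variable {β E : Type*} [MeasurableSpace β] {μ : Measure β} [NormedAddCommGroup E]
  [InnerProductSpace ℂ E]

/-- Multiplication by an essentially bounded operator-valued function. -/
noncomputable def mulOperator {B : β → E →L[ℂ] E} (hB : MemLp B ∞ μ) :
    Lp E 2 μ →L[ℂ] Lp E 2 μ :=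
  (ContinuousLinearMap.id ℂ (E →L[ℂ] E)).holderL μ ∞ 2 2 hB.toLp

theorem coeFn_mulOperator {B : β → E →L[ℂ] E} (hB : MemLp B ∞ μ) (g : Lp E 2 μ) :
    mulOperator hB g =ᵐ[μ] fun x => B x (g x) := by
  refine ((ContinuousLinearMap.id ℂ (E →L[ℂ] E)).coeFn_holder (r := 2) hB.toLp g).trans ?_
  filter_upwards [hB.coeFn_toLp] with x hx
  rw [hx]
  rfl

theorem inner_mulOperator {B : β → E →L[ℂ] E} (hB : MemLp B ∞ μ)
    (h : ∀ᵐ x ∂μ, ∀ u v, ⟪B x u, v⟫_ℂ = ⟪u, B x v⟫_ℂ) (f g : Lp E 2 μ) :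
    ⟪mulOperator hB f, g⟫_ℂ = ⟪f, mulOperator hB g⟫_ℂ := by
  rw [L2.inner_def, L2.inner_def]
  refine integral_congr_ae ?_
  filter_upwards [h, coeFn_mulOperator hB f, coeFn_mulOperator hB g] with x h1 h2 h3
  rw [h2, h3, h1]

/-- A non-negative integrand with integral zero vanishes almost everywhere; the pointwise
implication `h1` then finishes. -/
theorem mulOperator_eq_zero {B : β → E →L[ℂ] E} (hB : MemLp B ∞ μ)
    (h0 : ∀ x u, 0 ≤ (⟪u, B x u⟫_ℂ).re) (h1 : ∀ x u, (⟪u, B x u⟫_ℂ).re = 0 → B x u = 0)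
    {f : Lp E 2 μ} (hf : ⟪f, mulOperator hB f⟫_ℂ = 0) : mulOperator hB f = 0 := by
  rw [L2.inner_def] at hf
  have hi := L2.integrable_inner (𝕜 := ℂ) f (mulOperator hB f)
  have e := Complex.reCLM.integral_comp_comm hi
  simp only [Complex.reCLM_apply] at e
  have hi' : Integrable (fun x => (⟪f x, mulOperator hB f x⟫_ℂ).re) μ := hi.re
  rw [hf, Complex.zero_re, integral_eq_zero_iff_of_nonneg_ae ?_ hi'] at e
  · refine Lp.ext ?_
    filter_upwards [e, coeFn_mulOperator hB f, Lp.coeFn_zero E 2 μ] with x hx h2 h3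
    rw [h2, h3, Pi.zero_apply]
    refine h1 x _ ?_
    rw [← h2]
    exact hx
  · filter_upwards [coeFn_mulOperator hB f] with x hx
    rw [hx]
    exact h0 x _

end Multiplication

namespace System

open scoped InnerProductSpace ENNReal

variable {α : Type} [LinearOrder α] [DenselyOrdered α] [NoMinOrder α] [NoMaxOrder α]
  [TopologicalSpace α] [OrderTopology α] [SecondCountableTopology α] [CompactIccSpace α]
  [MeasurableSpace α] [BorelSpace α] {n : ℕ} {S : System α n} [IsFiniteMeasure S.measure]

theorem memLp_q (S : System α n) [IsFiniteMeasure S.measure] :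
    MemLp (S.q.relDensity S.measure) ∞ S.measure := by
  obtain ⟨C, hC⟩ := S.q.exists_ae_norm_relDensity_le S.variation_q_le
  exact memLp_top_of_bound (S.q.stronglyMeasurable_relDensity _).aestronglyMeasurable C hC

theorem memLp_w (S : System α n) [IsFiniteMeasure S.measure] :
    MemLp (S.w.relDensity S.measure) ∞ S.measure := by
  obtain ⟨C, hC⟩ := S.w.exists_ae_norm_relDensity_le S.variation_w_le
  exact memLp_top_of_bound (S.w.stronglyMeasurable_relDensity _).aestronglyMeasurable C hC

/-- The operator `g ↦ -J⁻¹ ∫ sign (· - t) / 2 g(t)`, the inverse of `J u'` with antiperiodic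
boundary conditions. -/
noncomputable def green (S : System α n) [IsFiniteMeasure S.measure] :
    Lp (EuclideanSpace ℂ (Fin n)) 2 S.measure →L[ℂ] Lp (EuclideanSpace ℂ (Fin n)) 2 S.measure :=
  (signKernel measurableSet_fst_lt_snd S.negInvJ).operator S.measure

theorem coeFn_green (z : ℂ) (f : Lp (EuclideanSpace ℂ (Fin n)) 2 S.measure) :
    S.green (mulOperator S.memLp_q f - z • mulOperator S.memLp_w f) =ᵐ[S.measure]
      fun x => ∫ t, halfSign x t • S.rhs z f t ∂S.measure := by
  refine (BoundedKernel.coeFn_operator _ _).trans (.of_forall fun x => integral_congr_ae ?_)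
  filter_upwards [coeFn_mulOperator S.memLp_q f, coeFn_mulOperator S.memLp_w f,
    Lp.coeFn_sub (mulOperator S.memLp_q f) (z • mulOperator S.memLp_w f),
    Lp.coeFn_smul z (mulOperator S.memLp_w f)] with t h1 h2 h3 h4
  rw [h3, Pi.sub_apply, h4, Pi.smul_apply, h1, h2]
  rfl

theorem rhs_congr {z : ℂ} {U V : α → EuclideanSpace ℂ (Fin n)} (h : U =ᵐ[S.measure] V) :
    S.rhs z U =ᵐ[S.measure] S.rhs z V := by
  filter_upwards [h] with x hx
  rw [rhs, rhs, hx]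

theorem integral_halfSign_rhs_congr {z z' : ℂ} {U V : α → EuclideanSpace ℂ (Fin n)}
    (h : S.rhs z U =ᵐ[S.measure] S.rhs z' V) (x : α) :
    ∫ t, halfSign x t • S.rhs z U t ∂S.measure = ∫ t, halfSign x t • S.rhs z' V t ∂S.measure := by
  refine integral_congr_ae ?_
  filter_upwards [h] with t ht
  rw [ht]

theorem inner_green (f g : Lp (EuclideanSpace ℂ (Fin n)) 2 S.measure) :
    ⟪S.green f, g⟫_ℂ = ⟪f, S.green g⟫_ℂ :=
  inner_signKernel_operator S.inner_negInvJ f g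

theorem inner_mulOperator_q (f g : Lp (EuclideanSpace ℂ (Fin n)) 2 S.measure) :
    ⟪mulOperator S.memLp_q f, g⟫_ℂ = ⟪f, mulOperator S.memLp_q g⟫_ℂ :=
  inner_mulOperator _ (S.q.ae_inner_relDensity S.variation_q_le S.hermitian_q) f g

theorem inner_mulOperator_w (f g : Lp (EuclideanSpace ℂ (Fin n)) 2 S.measure) :
    ⟪mulOperator S.memLp_w f, g⟫_ℂ = ⟪f, mulOperator S.memLp_w g⟫_ℂ :=
  inner_mulOperator _ (S.w.ae_inner_relDensity S.variation_w_le S.isHermitian_w) f g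

theorem mulOperator_w_eq_zero (f : Lp (EuclideanSpace ℂ (Fin n)) 2 S.measure)
    (hf : ⟪mulOperator S.memLp_w f, f⟫_ℂ = 0) : mulOperator S.memLp_w f = 0 :=
  mulOperator_eq_zero _ (S.w.re_inner_relDensity_nonneg S.nonneg_w)
    (fun _ _ => S.w.relDensity_apply_eq_zero S.nonneg_w) (by rwa [← inner_mulOperator_w])

namespace IsIntegralSolution

variable {z : ℂ} {c d : EuclideanSpace ℂ (Fin n)} {U V : α → EuclideanSpace ℂ (Fin n)}

theorem toLp_sub_green (h : S.IsIntegralSolution z c U) :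
    ((h.memLp.toLp - S.green (mulOperator S.memLp_q h.memLp.toLp -
      z • mulOperator S.memLp_w h.memLp.toLp) : Lp (EuclideanSpace ℂ (Fin n)) 2 S.measure) :
        α → EuclideanSpace ℂ (Fin n)) =ᵐ[S.measure] fun _ => c := by
  filter_upwards [Lp.coeFn_sub h.memLp.toLp (S.green (mulOperator S.memLp_q h.memLp.toLp -
      z • mulOperator S.memLp_w h.memLp.toLp)), coeFn_green z h.memLp.toLp, h.memLp.coeFn_toLp]
    with x h1 h2 h3
  rw [h1, Pi.sub_apply, h2, h3, h.eq x,
    integral_halfSign_rhs_congr (rhs_congr h.memLp.coeFn_toLp) x, add_sub_cancel_right]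

/-- Existence of solutions of the integral equation is invariant under conjugation of the spectral
parameter. -/
theorem exists_conj (h : S.IsIntegralSolution z c U) (hz : z.im ≠ 0) :
    ∃ V : α → Fin n → ℂ, S.IsIntegralSolution (star z) c fun x => WithLp.toLp 2 (V x) := by
  obtain ⟨f, hf⟩ := mem_range_conj (x := h.memLp.toLp) inner_green inner_mulOperator_q
    inner_mulOperator_w mulOperator_w_eq_zero
    (fun ε hε => exists_finiteRank_signKernel S.measure S.negInvJ hε) hz
  have hV : (fun x => c + ∫ t, halfSign x t • S.rhs (star z) f t ∂S.measure) =ᵐ[S.measure] f := by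
    filter_upwards [h.toLp_sub_green, Lp.coeFn_sub f (S.green (mulOperator S.memLp_q f -
      star z • mulOperator S.memLp_w f)), coeFn_green (star z) f] with x h1 h2 h3
    rw [← hf, h2, Pi.sub_apply, h3] at h1
    rw [← h1, sub_add_cancel]
  -- The class `f` satisfies the equation only almost everywhere. The right-hand side depends on the
  -- class alone, so evaluating it at every point gives a representative that satisfies the equation
  -- everywhere.
  refine ⟨fun x => (c + ∫ t, halfSign x t • S.rhs (star z) f t ∂S.measure).ofLp,
    (memLp_congr_ae hV).2 (Lp.memLp f), fun x => ?_⟩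
  exact congrArg (c + ·) (integral_halfSign_rhs_congr (rhs_congr hV.symm) x)

theorem add (hU : S.IsIntegralSolution z c U) (hV : S.IsIntegralSolution z d V) :
    S.IsIntegralSolution z (c + d) (U + V) := by
  refine ⟨hU.memLp.add hV.memLp, fun x => ?_⟩
  have e : ∀ t, halfSign x t • S.rhs z (U + V) t =
      halfSign x t • S.rhs z U t + halfSign x t • S.rhs z V t := fun t => by
    simp only [rhs, Pi.add_apply, map_add, smul_add]
  have hi : ∀ {W : α → EuclideanSpace ℂ (Fin n)}, Integrable W S.measure →
      Integrable (fun t => halfSign x t • S.rhs z W t) S.measure := fun hW =>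
    ((signKernel measurableSet_fst_lt_snd
      (ContinuousLinearMap.id ℂ (EuclideanSpace ℂ (Fin n)))).integrable_apply x
        (integrable_rhs hW) :)
  simp only [e]
  rw [integral_add (hi hU.integrable) (hi hV.integrable), Pi.add_apply, hU.eq x, hV.eq x]
  abel

theorem smul (k : ℂ) (hU : S.IsIntegralSolution z c U) :
    S.IsIntegralSolution z (k • c) (k • U) := by
  refine ⟨hU.memLp.const_smul k, fun x => ?_⟩
  have e : ∀ t, halfSign x t • S.rhs z (k • U) t = k • (halfSign x t • S.rhs z U t) := fun t => by
    simp only [rhs, Pi.smul_apply, map_smul]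
    rw [smul_comm]
  simp only [e]
  rw [integral_smul, Pi.smul_apply, hU.eq x, smul_add]

theorem zero (S : System α n) [IsFiniteMeasure S.measure] (z : ℂ) :
    S.IsIntegralSolution z 0 (0 : α → EuclideanSpace ℂ (Fin n)) := by
  refine ⟨MemLp.zero, fun x => ?_⟩
  simp [rhs]

/-- Constant term zero means a fixed point of `G (Q - z W)`, that is, a solution with antiperiodic
boundary values; for nonreal `z` such a solution has norm zero in `L²(w)`, although it need not be
zero. -/
theorem ae_relDensity_eq_zero (h : S.IsIntegralSolution z 0 U) (hz : z.im ≠ 0) :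
    ∀ᵐ x ∂S.measure, S.w.relDensity S.measure x (U x) = 0 := by
  have h0 : h.memLp.toLp = S.green (mulOperator S.memLp_q h.memLp.toLp -
      z • mulOperator S.memLp_w h.memLp.toLp) := by
    rw [← sub_eq_zero]
    exact Lp.ext (h.toLp_sub_green.trans (Lp.coeFn_zero _ 2 _).symm)
  have h1 := apply_eq_zero_of_eq_apply inner_green inner_mulOperator_q inner_mulOperator_w
    mulOperator_w_eq_zero hz h0
  have h2 := coeFn_mulOperator S.memLp_w h.memLp.toLp
  rw [h1] at h2
  filter_upwards [h2, Lp.coeFn_zero (EuclideanSpace ℂ (Fin n)) 2 S.measure, h.memLp.coeFn_toLp]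
    with x h3 h4 h5
  rw [← h5, ← h3, h4, Pi.zero_apply]

/-- The parameter enters the equation only through `z w U`. -/
theorem change_parameter (h : S.IsIntegralSolution z c U) (z' : ℂ)
    (h0 : ∀ᵐ x ∂S.measure, S.w.relDensity S.measure x (U x) = 0) :
    S.IsIntegralSolution z' c U := by
  refine ⟨h.memLp, fun x => (h.eq x).trans ?_⟩
  rw [integral_halfSign_rhs_congr (z' := z') (V := U)]
  filter_upwards [h0] with t ht
  simp [rhs, coeff, ht]

/-- Solutions for nonreal parameters with the same constant term vanish in `L²(w)`
simultaneously. -/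
theorem ae_relDensity_eq_zero_of_eq {z' : ℂ} (hU : S.IsIntegralSolution z c U)
    (hV : S.IsIntegralSolution z' c V) (hz' : z'.im ≠ 0)
    (h0 : ∀ᵐ x ∂S.measure, S.w.relDensity S.measure x (U x) = 0) :
    ∀ᵐ x ∂S.measure, S.w.relDensity S.measure x (V x) = 0 := by
  -- `U` solves the equation for `z'` too, so `U - V` is a solution for `z'` with constant term
  -- zero.
  have h1 := (hU.change_parameter z' h0).add (hV.smul (-1))
  rw [neg_one_smul, add_neg_cancel] at h1
  filter_upwards [h1.ae_relDensity_eq_zero hz', h0] with x h2 h3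
  simpa [h3] using h2

end IsIntegralSolution

end System

end BVSystem

/-! ### Comparison of the two defect spaces -/

namespace BVSystem
open MeasureTheory Set Topology Filter
open scoped ComplexOrder Matrix

theorem rank_eq_of_surjective_of_ker_eq {R V W W' : Type} [Ring R] [AddCommGroup V] [Module R V]
    [AddCommGroup W] [Module R W] [AddCommGroup W'] [Module R W'] (f : V →ₗ[R] W)
    (g : V →ₗ[R] W') (hf : Function.Surjective f) (hg : Function.Surjective g)
    (h : LinearMap.ker f = LinearMap.ker g) :
    Module.rank R W = Module.rank R W' :=
  (((f.quotKerEquivOfSurjective hf).symm.trans (Submodule.quotEquivOfEq _ _ h)).trans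
    (g.quotKerEquivOfSurjective hg)).rank_eq

namespace System

open scoped InnerProductSpace ENNReal

variable {α : Type} [LinearOrder α] [DenselyOrdered α] [NoMinOrder α] [NoMaxOrder α]
  [TopologicalSpace α] [OrderTopology α] [SecondCountableTopology α] [CompactIccSpace α]
  [MeasurableSpace α] [BorelSpace α] {n : ℕ}

/-- A null function `h` of `L²(w)` has `h* w h = 0` almost everywhere, hence `w h = 0` by
positivity, so the right-hand side of the equation depends on the class only. -/
theorem Solves.congr_right {S : System α n} {u : α → Fin n → ℂ} {f g : S.preL2}
    (h : S.Solves u f) (hfg : f - g ∈ S.nullL2) : S.Solves u g := by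
  intro c d hcd
  rw [h c d hcd, MatrixDistribution.integralOn, MatrixDistribution.integralOn]
  refine integral_congr_ae (ae_restrict_of_ae ?_)
  filter_upwards [(S.inner_self_eq_zero_iff (f - g).2).1 hfg] with x hx
  have h1 := ((S.w.posSemidef_density S.nonneg_w x).dotProduct_mulVec_zero_iff _).1 hx
  rw [← sub_eq_zero, ← Matrix.mulVec_sub]
  exact h1

variable (S : System α n) [IsFiniteMeasure S.measure]

/-- Pairs of solutions of the integral equation for the parameters `z` and `z'` with the same
constant term. -/
def solutionPairs (z z' : ℂ) : Submodule ℂ (S.preL2 × S.preL2) where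
  carrier := {p | ∃ c,
    S.IsIntegralSolution z c (fun x => WithLp.toLp 2 ((p.1 : α → Fin n → ℂ) x)) ∧
    S.IsIntegralSolution z' c (fun x => WithLp.toLp 2 ((p.2 : α → Fin n → ℂ) x))}
  add_mem' := fun ⟨c, h1, h2⟩ ⟨d, h3, h4⟩ => ⟨c + d, h1.add h3, h2.add h4⟩
  zero_mem' := ⟨0, .zero S z, .zero S z'⟩
  smul_mem' := fun k _ ⟨c, h1, h2⟩ => ⟨k • c, h1.smul k, h2.smul k⟩

variable {S}

theorem mem_defectSpace {z : ℂ} {c : EuclideanSpace ℂ (Fin n)} {u : S.preL2}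
    (h : S.IsIntegralSolution z c fun x => WithLp.toLp 2 ((u : α → Fin n → ℂ) x)) :
    (S.nullL2.mkQ.prod (z • S.nullL2.mkQ)) u ∈ S.defectSpace z := by
  refine ⟨⟨(u, z • u), ⟨h.isBalancedBV, h.solves⟩, ?_⟩, rfl⟩
  simp

/-- Membership gives `J u' + q u = w f` with `f = z u` only as classes; `f` can be replaced by `z u`
itself, and then `u` satisfies the integral equation. -/
theorem exists_of_mem_defectSpace {z : ℂ} {p : S.L2 × S.L2} (hp : p ∈ S.defectSpace z) :
    ∃ (c : EuclideanSpace ℂ (Fin n)) (u : S.preL2),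
      S.IsIntegralSolution z c (fun x => WithLp.toLp 2 ((u : α → Fin n → ℂ) x)) ∧
      (S.nullL2.mkQ.prod (z • S.nullL2.mkQ)) u = p := by
  obtain ⟨⟨⟨u, f⟩, ⟨hu, hs⟩, rfl⟩, h2⟩ := hp
  have h3 : f - z • u ∈ S.nullL2 := by
    rw [← Submodule.Quotient.mk_eq_zero, Submodule.Quotient.mk_sub, Submodule.Quotient.mk_smul,
      sub_eq_zero]
    exact h2
  obtain ⟨c, hc⟩ := exists_isIntegralSolution hu (hs.congr_right h3)
  exact ⟨c, u, hc, Prod.ext rfl h2.symm⟩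

theorem mkQ_prod_eq_zero_iff {z : ℂ} {c : EuclideanSpace ℂ (Fin n)} {u : S.preL2}
    (h : S.IsIntegralSolution z c fun x => WithLp.toLp 2 ((u : α → Fin n → ℂ) x)) :
    (S.nullL2.mkQ.prod (z • S.nullL2.mkQ)) u = 0 ↔
      ∀ᵐ x ∂S.measure, S.w.relDensity S.measure x (WithLp.toLp 2 ((u : α → Fin n → ℂ) x)) = 0 := by
  rw [← inner_self_eq_zero_iff_relDensity h.memLp]
  have : S.inner u u = 0 ↔ S.nullL2.mkQ u = 0 := by
    change u ∈ S.nullL2 ↔ _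
    exact (Submodule.Quotient.mk_eq_zero S.nullL2).symm
  rw [this]
  refine ⟨fun h => congrArg Prod.fst h, fun h => Prod.ext h ?_⟩
  change z • S.nullL2.mkQ u = 0
  rw [h, smul_zero]

/-- The map of pairs of solutions to the class of the first one. -/
noncomputable def fstDefect (S : System α n) [IsFiniteMeasure S.measure] (z z' : ℂ) :
    S.solutionPairs z z' →ₗ[ℂ] S.defectSpace z :=
  LinearMap.codRestrict _ ((S.nullL2.mkQ.prod (z • S.nullL2.mkQ)) ∘ₗ
    LinearMap.fst ℂ S.preL2 S.preL2 ∘ₗ (S.solutionPairs z z').subtype)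
    fun p => mem_defectSpace p.2.choose_spec.1

/-- The map of pairs of solutions to the class of the second one. -/
noncomputable def sndDefect (S : System α n) [IsFiniteMeasure S.measure] (z z' : ℂ) :
    S.solutionPairs z z' →ₗ[ℂ] S.defectSpace z' :=
  LinearMap.codRestrict _ ((S.nullL2.mkQ.prod (z' • S.nullL2.mkQ)) ∘ₗ
    LinearMap.snd ℂ S.preL2 S.preL2 ∘ₗ (S.solutionPairs z z').subtype)
    fun p => mem_defectSpace p.2.choose_spec.2

/-- The constant of any solution for `z` also admits a solution for `star z`, which completes the
pair. -/
theorem fstDefect_surjective {z : ℂ} (hz : z.im ≠ 0) :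
    Function.Surjective (S.fstDefect z (star z)) := by
  rintro ⟨p, hp⟩
  obtain ⟨c, u, hu, rfl⟩ := exists_of_mem_defectSpace hp
  obtain ⟨v, hv⟩ := hu.exists_conj hz
  exact ⟨⟨(u, ⟨v, memL2_of_memLp hv.memLp⟩), c, hu, hv⟩, rfl⟩

theorem sndDefect_surjective {z : ℂ} (hz : z.im ≠ 0) :
    Function.Surjective (S.sndDefect z (star z)) := by
  rintro ⟨p, hp⟩
  obtain ⟨c, u, hu, rfl⟩ := exists_of_mem_defectSpace hp
  obtain ⟨v, hv⟩ := hu.exists_conj (by simpa using hz)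
  rw [star_star] at hv
  exact ⟨⟨(⟨v, memL2_of_memLp hv.memLp⟩, u), c, hv, hu⟩, rfl⟩

/-- In a pair with common constant term, one member has norm zero in `L²(w)` exactly when the other
has; the two directions are one lemma with the roles of `z` and `star z` exchanged. -/
theorem ker_fstDefect {z : ℂ} (hz : z.im ≠ 0) :
    LinearMap.ker (S.fstDefect z (star z)) = LinearMap.ker (S.sndDefect z (star z)) := by
  ext ⟨p, c, h1, h2⟩
  rw [LinearMap.mem_ker, LinearMap.mem_ker, ← Subtype.coe_inj, ← Subtype.coe_inj]
  refine (mkQ_prod_eq_zero_iff h1).trans (Iff.trans ?_ (mkQ_prod_eq_zero_iff h2).symm)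
  exact ⟨h1.ae_relDensity_eq_zero_of_eq h2 (by simpa using hz),
    h2.ae_relDensity_eq_zero_of_eq h1 hz⟩

theorem rank_defectSpace_star {z : ℂ} (hz : z.im ≠ 0) :
    Module.rank ℂ (S.defectSpace z) = Module.rank ℂ (S.defectSpace (star z)) := by
  exact rank_eq_of_surjective_of_ker_eq (V := S.solutionPairs z (star z))
    (W := S.defectSpace z) (W' := S.defectSpace (star z)) (S.fstDefect z (star z)) (S.sndDefect z (star z))
    (fstDefect_surjective hz) (sndDefect_surjective hz) (ker_fstDefect hz)

end System

end BVSystem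

theorem mainTheorem8 (a b : EReal) (hab : a < b) (n : ℕ)
    (S : BVSystem.System (BVSystem.OpenInterval a b) n)
    (ha : S.RegularLeft) (hb : S.RegularRight) :
    S.nPlus = S.nMinus := by
  have := BVSystem.System.isFiniteMeasure_measure ha hb
  have h := BVSystem.System.rank_defectSpace_star (S := S) (z := Complex.I) (by simp)
  rwa [Complex.star_def, Complex.conj_I] at h
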